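/- **Conventions.** A *$k$-graph* is a countable small category $\Lambda$ with a functor $d:\Lambda\to\mathbb N^k$ such that whenever $d(\lambda)=m+n$ there are unique $\mu,\nu\in\Lambda$ with $d(\mu)=m$, $d(\nu)=n$, $\lambda=\mu\nu$. Write $r,s$ for range and source; $\lambda\mu$ is defined when $s(\lambda)=r(\mu)$, and $v\Lambda=\{\lambda: r(\lambda)=v\}$. Let $\Lambda^{\min}(\lambda,\mu)$ be the set of pairs $(\rho,\tau)$ with $\lambda\rho=\mu\tau$ and $d(\lambda\rho)=d(\lambda)\vee d(\mu)$; $\Lambda$ is *finitely aligned* if all these sets are finite. A set $E\subseteq v\Lambda$ is *exhaustive* if for every $\lambda\in v\Lambda$ there is $\mu\in E$ with $\Lambda^{\min}(\lambda,\mu)\ne\emptyset$. For $m\in(\mathbb N\cup\{\infty\})^k$, $\Omega_{k,m}$ is the $k$-graph of pairs $(p,q)\in\mathbb N^k\times\mathbb N^k$ with $p\le q\le m$, $r(p,q)=p$, $s(p,q)=q$, $d(p,q)=q-p$. A *boundary path* of degree $d(x)=m$ is a degree-preserving functor $x:\Omega_{k,m}\to\Lambda$ such that for every $n\in\mathbb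 N^k$, $n\le m$, and every finite exhaustive $E\subseteq x(n,n)\Lambda$ there is $\lambda\in E$ with $n+d(\lambda)\le m$ and $x(n,n+d(\lambda))=\lambda$. The set $\partial\Lambda$ of boundary paths has the topology with basis the sets $Z(\lambda\setminus G)=Z(\lambda)\setminus\bigcup_{\nu\in G}Z(\lambda\nu)$, where $Z(\lambda)=\{x: d(\lambda)\le d(x),\ x(0,d(\lambda))=\lambda\}$ and $G\subseteq s(\lambda)\Lambda$ is finite and not exhaustive. For $m\in\mathbb N^k$ let $\partial\Lambda^{\ge m}=\{x:d(x)\ge m\}$ and let $\sigma^m:\partial\Lambda^{\ge m}\to\partial\Lambda$, $\sigma^m(x)(p,q)=x(p+m,q+m)$, be the shift; any formula containing $\sigma^m(x)$ or $x(0,m)$ includes the requirement $m\le d(x)$. The *boundary path groupoid* is $$\mathcal G_\Lambda=\{(x,p-q,y): x,y\in\partial\Lambda,\ p,q\in\mathbb N^k,\ \sigma^p(x)=\sigma^q(y)\}\subseteq\partial\Lambda\times\mathbb Z^k\times\partial\Lambda$$ with $(x,m,y)(y,n,z)=(x,m+n,z)$ and $(x,m,y)^{-1}=(y,-m,x)$,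 and with the topology with basis $Z(\lambda *_s\mu\setminus G)=Z(\lambda*_s\mu)\setminus\bigcup_{\nu\in G}Z(\lambda\nu*_s\mu\nu)$, where $s(\lambda)=s(\mu)$, $G\subseteq s(\lambda)\Lambda$ is finite and not exhaustive, and $Z(\lambda*_s\mu)=\{(x,d(\lambda)-d(\mu),y): x\in Z(\lambda),\ y\in Z(\mu),\ \sigma^{d(\lambda)}(x)=\sigma^{d(\mu)}(y)\}$. An *isomorphism* of such groupoids is a homeomorphism preserving composability and products. For a functor $\eta$ from $\Lambda$ to a group $\Gamma$, $c_\eta:\mathcal G_\Lambda\to\Gamma$ is the cocycle $c_\eta(x,p-q,y)=\eta(x(0,p))\,\eta(y(0,q))^{-1}$ whenever $\sigma^p(x)=\sigma^q(y)$. For $x\in\partial\Lambda$ put $$\operatorname{Per}(x)=\{m-n: \sigma^m(x)=\sigma^n(x)\},\qquad \operatorname{IP}(x)=\{m-n: \sigma^m=\sigma^n\text{ on an open neighbourhood of }x\}$$ with $m,n\in\mathbb N^k$, and $\operatorname{orb}(x)=\{y:\sigma^n(y)=\sigma^m(x)\text{ for some }m,n\in\mathbb N^k\}$. Let $\Lambda_1$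 be a finitely aligned $k_1$-graph, $\Lambda_2$ a finitely aligned $k_2$-graph, and $h:\partial\Lambda_1\to\partial\Lambda_2$ a homeomorphism. It is an *orbit equivalence* if $h(\operatorname{orb}(x))=\operatorname{orb}(h(x))$ for all $x\in\partial\Lambda_1$. A *family of continuous cocycles* for $h$ consists of continuous maps $f_m,g_m:\partial\Lambda_1^{\ge m}\to\mathbb N^{k_2}$ ($m\in\mathbb N^{k_1}$) and $i_n,j_n:\partial\Lambda_2^{\ge n}\to\mathbb N^{k_1}$ ($n\in\mathbb N^{k_2}$) such that $$\sigma^{f_m(x)}(h(\sigma^m(x)))=\sigma^{g_m(x)}(h(x)),$$ $$g_{m+n}(x)-f_{m+n}(x)=g_m(x)-f_m(x)+g_n(\sigma^m(x))-f_n(\sigma^m(x))$$ for all $x\in\partial\Lambda_1^{\ge m}$, respectively $x\in\partial\Lambda_1^{\ge m+n}$, and such that $i,j$ satisfy the same two conditions with $(h,\Lambda_1,\Lambda_2,f,g)$ replaced by $(h^{-1},\Lambda_2,\Lambda_1,i,j)$. An orbit equivalence that has such a family is a *continuous orbit equivalence*. Given functors $\eta_i:\Lambda_i\to\Gamma$,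 the family is *$\Gamma$-graded* if $$\eta_1(x(0,m))=\eta_2\big(h(x)(0,g_m(x))\big)\,\eta_2\big(h(\sigma^m(x))(0,f_m(x))\big)^{-1}\quad (m\in\mathbb N^{k_1},\ x\in\partial\Lambda_1^{\ge m}),$$ it is *period-preserving* if for all $x\in\partial\Lambda_1$ $$\{g_m(x)-f_m(x)-g_n(x)+f_n(x): m,n\in\mathbb N^{k_1},\ \sigma^m(x)=\sigma^n(x)\}=\operatorname{Per}(h(x)),$$ and it *preserves inner periodicity* if for all $x\in\partial\Lambda_1$ $$\{g_m(x)-f_m(x)-g_n(x)+f_n(x): m,n\in\mathbb N^{k_1},\ \sigma^m=\sigma^n\text{ on an open neighbourhood of }x\}=\operatorname{IP}(h(x)),$$ where each time the corresponding condition with $(h,\Lambda_1,\Lambda_2,\eta_1,\eta_2,f,g)$ replaced by $(h^{-1},\Lambda_2,\Lambda_1,\eta_2,\eta_1,i,j)$ is required as well. **Proposition.** Let $\Gamma$ be a discrete group, $\Lambda_1$ a finitely aligned $k_1$-graph, $\Lambda_2$ a finitely aligned $k_2$-graph, $\eta_1:\Lambda_1\to\Gamma$ and $\eta_2:\Lambda_2\to\Gamma$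 functors, and $h:\partial\Lambda_1\to\partial\Lambda_2$ a homeomorphism. The following are equivalent. 1. There is an isomorphism $\phi:\mathcal G_{\Lambda_1}\to\mathcal G_{\Lambda_2}$ of topological groupoids such that $c_{\eta_2}\circ\phi=c_{\eta_1}$ and $\phi(x,0,x)=(h(x),0,h(x))$ for all $x\in\partial\Lambda_1$. 2. $h$ is an orbit equivalence with a family of continuous cocycles that is both $\Gamma$-graded and period-preserving. 3. $h$ is an orbit equivalence with a family of continuous cocycles that is $\Gamma$-graded and preserves inner periodicity. -/

import Mathlib

universe u v w

/-- A higher-rank graph of rank `k`: a countable small category, given by its objects, its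
morphisms, range, source, identities and composition (`comp a b` is the product `a b`,
defined when `s a = r b`), with a degree functor to `ℕ ^ k` that has the factorisation property. -/
structure KGraph (k : ℕ) where
  Vertex : Type u
  Mor : Type u
  r : Mor → Vertex
  s : Mor → Vertex
  one : Vertex → Mor
  comp : (a b : Mor) → s a = r b → Mor
  r_one : ∀ v, r (one v) = v
  s_one : ∀ v, s (one v) = v
  r_comp : ∀ a b h, r (comp a b h) = r a
  s_comp : ∀ a b h, s (comp a b h) = s b
  one_comp : ∀ a, comp (one (r a)) a (s_one _) = a
  comp_one : ∀ a, comp a (one (s a)) (r_one _).symm = a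
  assoc : ∀ a b c (hab : s a = r b) (hbc : s b = r c),
    comp (comp a b hab) c ((s_comp a b hab).trans hbc) =
      comp a (comp b c hbc) (hab.trans (r_comp b c hbc).symm)
  d : Mor → Fin k → ℕ
  d_one : ∀ v, d (one v) = 0
  d_comp : ∀ a b h, d (comp a b h) = d a + d b
  factorisation : ∀ (a : Mor) (m n : Fin k → ℕ), d a = m + n →
    ∃! p : Mor × Mor, d p.1 = m ∧ d p.2 = n ∧ ∃ h : s p.1 = r p.2, comp p.1 p.2 h = a
  countable_mor : Countable Mor

namespace KGraph

/-- `ℕ ^ k` inside `(ℕ ∪ {∞}) ^ k`. -/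
abbrev toE {k : ℕ} (m : Fin k → ℕ) : Fin k → ℕ∞ := fun i => (m i : ℕ∞)

/-- `ℕ ^ k` inside `ℤ ^ k`. -/
abbrev toZ {k : ℕ} (m : Fin k → ℕ) : Fin k → ℤ := fun i => (m i : ℤ)

section Basic

variable {k : ℕ} (Λ : KGraph.{u} k)

/-- `a` is an initial segment of `c`; by unique factorisation this says `c(0, d(a)) = a`. -/
def IsInitial (a c : Λ.Mor) : Prop :=
  ∃ (b : Λ.Mor) (h : Λ.s a = Λ.r b), Λ.comp a b h = c

/-- The minimal common extensions of `a` and `b`. -/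
def MCE (a b : Λ.Mor) : Set Λ.Mor :=
  {c | Λ.d c = Λ.d a ⊔ Λ.d b ∧ Λ.IsInitial a c ∧ Λ.IsInitial b c}

/-- The set `Λ^min(a, b)`. -/
def minExt (a b : Λ.Mor) : Set (Λ.Mor × Λ.Mor) :=
  {p | ∃ (h₁ : Λ.s a = Λ.r p.1) (h₂ : Λ.s b = Λ.r p.2),
    Λ.comp a p.1 h₁ = Λ.comp b p.2 h₂ ∧ Λ.comp a p.1 h₁ ∈ Λ.MCE a b}

def FinitelyAligned : Prop := ∀ a b : Λ.Mor, (Λ.minExt a b).Finite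

/-- `E` is an exhaustive subset of `v Λ`. -/
def Exhaustive (v : Λ.Vertex) (E : Set Λ.Mor) : Prop :=
  (∀ b ∈ E, Λ.r b = v) ∧ ∀ a : Λ.Mor, Λ.r a = v → ∃ b ∈ E, (Λ.minExt a b).Nonempty

/-- A boundary path of degree `deg`: a degree-preserving functor from `Ω_{k, deg}` to `Λ`, with
object map `vert` (objects are the `p ≤ deg`) and morphism map `seg` (morphisms are the pairs
`p ≤ q ≤ deg`, with range `p` and source `q`), that meets every finite exhaustive set. -/
structure BoundaryPath where
  deg : Fin k → ℕ∞
  vert : (p : Fin k → ℕ) → toE p ≤ deg → Λ.Vertex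
  seg : (p q : Fin k → ℕ) → p ≤ q → toE q ≤ deg → Λ.Mor
  r_seg : ∀ p q hpq hq hp, Λ.r (seg p q hpq hq) = vert p hp
  s_seg : ∀ p q hpq hq, Λ.s (seg p q hpq hq) = vert q hq
  seg_self : ∀ p hp, seg p p le_rfl hp = Λ.one (vert p hp)
  seg_comp : ∀ p q t (hpq : p ≤ q) (hqt : q ≤ t) (hq : toE q ≤ deg) (ht : toE t ≤ deg),
    seg p t (hpq.trans hqt) ht =
      Λ.comp (seg p q hpq hq) (seg q t hqt ht) ((s_seg p q hpq hq).trans (r_seg q t hqt ht hq).symm)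
  d_seg : ∀ p q hpq hq, p + Λ.d (seg p q hpq hq) = q
  boundary : ∀ n (hn : toE n ≤ deg) (E : Set Λ.Mor), E.Finite → Λ.Exhaustive (vert n hn) E →
    ∃ a ∈ E, ∃ h : toE (n + Λ.d a) ≤ deg, seg n (n + Λ.d a) le_self_add h = a

end Basic

section Shift

theorem toE_mono {k : ℕ} {m n : Fin k → ℕ} (h : m ≤ n) : toE m ≤ toE n :=
  fun i => Nat.cast_le.mpr (h i)

theorem toE_add_le {k : ℕ} {m n : Fin k → ℕ} {e : Fin k → ℕ∞} (hm : toE m ≤ e)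
    (hn : toE n ≤ e - toE m) : toE (n + m) ≤ e := by
  intro i
  have h1 := add_le_add_left (hn i) (m i : ℕ∞)
  have h2 : (e i - (m i : ℕ∞)) + (m i : ℕ∞) = e i := tsub_add_cancel_of_le (hm i)
  simp only [Pi.sub_apply, toE] at h1
  rw [h2] at h1
  simpa [toE] using h1

theorem le_sub_of_toE_add_le {k : ℕ} {m n : Fin k → ℕ} {e : Fin k → ℕ∞}
    (h : toE (n + m) ≤ e) : toE n ≤ e - toE m := by
  intro i
  have h1 : (n i : ℕ∞) + (m i : ℕ∞) ≤ e i := by simpa [toE] using h i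
  simpa [toE] using ENat.le_sub_of_add_le_right (ENat.natCast_ne_top _) h1

theorem toE_le_left {k : ℕ} {m n : Fin k → ℕ} {e : Fin k → ℕ∞} (h : toE (m + n) ≤ e) :
    toE m ≤ e :=
  (toE_mono le_self_add).trans h

variable {k : ℕ} {Λ : KGraph.{u} k}

namespace BoundaryPath

theorem seg_congr (x : Λ.BoundaryPath) {p p' q q' : Fin k → ℕ} (hp : p = p') (hq : q = q')
    (h₁ : p ≤ q) (h₂ : toE q ≤ x.deg) (h₁' : p' ≤ q') (h₂' : toE q' ≤ x.deg) :
    x.seg p q h₁ h₂ = x.seg p' q' h₁' h₂' := by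
  subst hp; subst hq; rfl

theorem ext_seg {x y : Λ.BoundaryPath} (hd : x.deg = y.deg)
    (hs : ∀ p q hpq hx hy, x.seg p q hpq hx = y.seg p q hpq hy) : x = y := by
  obtain ⟨d₁, v₁, s₁, a₁, b₁, c₁, e₁, f₁, g₁⟩ := x
  obtain ⟨d₂, v₂, s₂, a₂, b₂, c₂, e₂, f₂, g₂⟩ := y
  dsimp only at hd
  subst hd
  have h1 : s₁ = s₂ := by
    funext p q hpq hq
    exact hs p q hpq hq hq
  subst h1
  have h2 : v₁ = v₂ := by
    funext p hp
    rw [← a₁ p p le_rfl hp hp, a₂ p p le_rfl hp hp]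
  subst h2
  rfl

/-- The initial segment `x(0, m)`. -/
def initial (x : Λ.BoundaryPath) (m : Fin k → ℕ) (hm : toE m ≤ x.deg) : Λ.Mor :=
  x.seg 0 m zero_le hm

/-- The shift `σ^m(x)`, defined for `m ≤ d(x)`: `σ^m(x)(p, q) = x(p + m, q + m)`. -/
def shift (x : Λ.BoundaryPath) (m : Fin k → ℕ) (hm : toE m ≤ x.deg) : Λ.BoundaryPath where
  deg := x.deg - toE m
  vert p hp := x.vert (p + m) (toE_add_le hm hp)
  seg p q hpq hq := x.seg (p + m) (q + m) (add_le_add_left hpq m) (toE_add_le hm hq)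
  r_seg p q hpq hq hp := x.r_seg _ _ _ _ _
  s_seg p q hpq hq := x.s_seg _ _ _ _
  seg_self p hp := x.seg_self _ _
  seg_comp p q t hpq hqt hq ht := x.seg_comp _ _ _ _ _ _ _
  d_seg p q hpq hq := by
    have h := x.d_seg (p + m) (q + m) (add_le_add_left hpq m) (toE_add_le hm hq)
    rw [add_right_comm] at h
    exact add_right_cancel h
  boundary n hn E hE hex := by
    obtain ⟨a, ha, h, hseg⟩ := x.boundary (n + m) (toE_add_le hm hn) E hE hex
    have h' : toE (n + Λ.d a + m) ≤ x.deg := by rwa [add_right_comm]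
    exact ⟨a, ha, le_sub_of_toE_add_le h',
      (x.seg_congr rfl (add_right_comm n (Λ.d a) m) _ _ _ _).trans hseg⟩

theorem le_shift_deg {x : Λ.BoundaryPath} {m n : Fin k → ℕ} (h : toE (m + n) ≤ x.deg) :
    toE n ≤ (x.shift m (toE_le_left h)).deg :=
  le_sub_of_toE_add_le (by rwa [add_comm])

theorem shift_shift (x : Λ.BoundaryPath) {m n t : Fin k → ℕ} (ht : t = m + n)
    (h : toE t ≤ x.deg) (hm : toE m ≤ x.deg) (hn : toE n ≤ (x.shift m hm).deg) :
    (x.shift m hm).shift n hn = x.shift t h := by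
  subst ht
  refine ext_seg ?_ ?_
  · funext i
    change x.deg i - (m i : ℕ∞) - (n i : ℕ∞) = x.deg i - ((m i + n i : ℕ) : ℕ∞)
    rw [tsub_tsub]
    push_cast
    rfl
  · intro p q hpq hx hy
    exact x.seg_congr (by rw [add_assoc, add_comm n]) (by rw [add_assoc, add_comm n]) _ _ _ _

theorem shift_congr {x y : Λ.BoundaryPath} (hxy : x = y) {n : Fin k → ℕ}
    (hx : toE n ≤ x.deg) (hy : toE n ≤ y.deg) : x.shift n hx = y.shift n hy := by
  subst hxy; rfl

theorem seg_of_eq {x y : Λ.BoundaryPath} (hxy : x = y) {p q : Fin k → ℕ} (hpq : p ≤ q)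
    (hx : toE q ≤ x.deg) (hy : toE q ≤ y.deg) : x.seg p q hpq hx = y.seg p q hpq hy := by
  subst hxy; rfl

/-- If `σ^p(x) = σ^q(y)`, then `σ^{p+a}(x) = σ^{q+a}(y)` as soon as one side is defined. -/
theorem shift_eq_add {x y : Λ.BoundaryPath} {p q a P Q : Fin k → ℕ} (hP : P = p + a)
    (hQ : Q = q + a) (hp : toE p ≤ x.deg) (hq : toE q ≤ y.deg)
    (h : x.shift p hp = y.shift q hq) (hPx : toE P ≤ x.deg) :
    ∃ hQy : toE Q ≤ y.deg, x.shift P hPx = y.shift Q hQy := by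
  subst hP; subst hQ
  have h1 : toE a ≤ (x.shift p hp).deg := le_shift_deg hPx
  have h2 : toE a ≤ (y.shift q hq).deg := h ▸ h1
  have h3 : toE (q + a) ≤ y.deg := by
    rw [add_comm]
    exact toE_add_le hq h2
  refine ⟨h3, ?_⟩
  rw [← shift_shift x rfl hPx hp h1, ← shift_shift y rfl h3 hq h2]
  exact shift_congr h h1 h2

end BoundaryPath

end Shift

section Topology

variable {k : ℕ} (Λ : KGraph.{u} k)

/-- The cylinder set `Z(a) = a ∂Λ`, i.e. the boundary paths `x` with `x(0, d(a)) = a`. -/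
def cyl (a : Λ.Mor) : Set Λ.BoundaryPath :=
  {x | ∃ h : toE (Λ.d a) ≤ x.deg, x.initial (Λ.d a) h = a}

/-- `Z(a \ G)` for `G ⊆ s(a) Λ`. -/
def cylDiff (a : Λ.Mor) (G : Set Λ.Mor) : Set Λ.BoundaryPath :=
  {x | x ∈ Λ.cyl a ∧ ∀ c ∈ G, ∀ h : Λ.s a = Λ.r c, x ∉ Λ.cyl (Λ.comp a c h)}

/-- `G` is a finite nonexhaustive subset of `v Λ`. -/
def FiniteNonexhaustive (v : Λ.Vertex) (G : Set Λ.Mor) : Prop :=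
  G.Finite ∧ (∀ c ∈ G, Λ.r c = v) ∧ ¬ Λ.Exhaustive v G

/-- The topology of `∂Λ`, generated by the sets `Z(a \ G)`. -/
instance : TopologicalSpace Λ.BoundaryPath :=
  TopologicalSpace.generateFrom
    {U | ∃ a G, Λ.FiniteNonexhaustive (Λ.s a) G ∧ U = Λ.cylDiff a G}

end Topology

section Groupoid

variable {k : ℕ} (Λ : KGraph.{u} k)

/-- The elements `(x, m, y)` of the boundary path groupoid, with `x = rng`, `m = lag`,
`y = src`. -/
@[ext]
structure BPGroupoid where
  rng : Λ.BoundaryPath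
  lag : Fin k → ℤ
  src : Λ.BoundaryPath
  mem : ∃ (p q : Fin k → ℕ) (hp : toE p ≤ rng.deg) (hq : toE q ≤ src.deg),
    toZ p - toZ q = lag ∧ rng.shift p hp = src.shift q hq

variable {Λ}

namespace BPGroupoid

/-- The unit `(x, 0, x)`. -/
def unit (x : Λ.BoundaryPath) : Λ.BPGroupoid where
  rng := x
  lag := 0
  src := x
  mem := ⟨0, 0, fun _ => zero_le, fun _ => zero_le, sub_self _, rfl⟩

/-- The inverse `(y, -m, x)` of `(x, m, y)`. -/
def inv (g : Λ.BPGroupoid) : Λ.BPGroupoid where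
  rng := g.src
  lag := -g.lag
  src := g.rng
  mem := by
    obtain ⟨p, q, hp, hq, hl, h⟩ := g.mem
    exact ⟨q, p, hq, hp, by rw [← hl, neg_sub], h.symm⟩

/-- The product `(x, m, y)(y, n, z) = (x, m + n, z)`. -/
def mul (g g' : Λ.BPGroupoid) (hc : g.src = g'.rng) : Λ.BPGroupoid where
  rng := g.rng
  lag := g.lag + g'.lag
  src := g'.src
  mem := by
    obtain ⟨x, m, y, p, q, hp, hq, hl, h⟩ := g
    obtain ⟨y', n, z, p', q', hp', hq', hl', h'⟩ := g'
    dsimp only at hc hp hq hp' hq' ⊢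
    subst hc
    have hj : toE (q ⊔ p') ≤ y.deg := by
      intro i
      rcases le_total (q i) (p' i) with hi | hi
      · simpa [toE, hi] using hp' i
      · simpa [toE, hi] using hq i
    obtain ⟨hP, e₁⟩ := BoundaryPath.shift_eq_add (P := q ⊔ p') (a := q ⊔ p' - q)
      (add_tsub_cancel_of_le le_sup_left).symm rfl hq hp h.symm hj
    obtain ⟨hQ, e₂⟩ := BoundaryPath.shift_eq_add (P := q ⊔ p') (a := q ⊔ p' - p')
      (add_tsub_cancel_of_le le_sup_right).symm rfl hp' hq' h' hj
    refine ⟨_, _, hP, hQ, ?_, e₁.symm.trans e₂⟩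
    rw [← hl, ← hl']
    funext i
    simp only [toZ, Pi.sub_apply, Pi.add_apply, Pi.sup_apply]
    omega

end BPGroupoid

variable (Λ)

/-- `Z(a *_s b)`, for `s(a) = s(b)`: the elements `(a x, d(a) - d(b), b x)`. -/
def bisec (a b : Λ.Mor) : Set Λ.BPGroupoid :=
  {g | g.lag = toZ (Λ.d a) - toZ (Λ.d b) ∧ g.rng ∈ Λ.cyl a ∧ g.src ∈ Λ.cyl b ∧
    ∃ (ha : toE (Λ.d a) ≤ g.rng.deg) (hb : toE (Λ.d b) ≤ g.src.deg),
      g.rng.shift (Λ.d a) ha = g.src.shift (Λ.d b) hb}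

/-- `Z(a *_s b \ G)` for `G ⊆ s(a) Λ`. -/
def bisecDiff (a b : Λ.Mor) (G : Set Λ.Mor) : Set Λ.BPGroupoid :=
  {g | g ∈ Λ.bisec a b ∧ ∀ c ∈ G, ∀ (ha : Λ.s a = Λ.r c) (hb : Λ.s b = Λ.r c),
    g ∉ Λ.bisec (Λ.comp a c ha) (Λ.comp b c hb)}

/-- The topology of the boundary path groupoid, generated by the sets `Z(a *_s b \ G)`. -/
instance : TopologicalSpace Λ.BPGroupoid :=
  TopologicalSpace.generateFrom
    {U | ∃ a b G, Λ.s a = Λ.s b ∧ Λ.FiniteNonexhaustive (Λ.s a) G ∧ U = Λ.bisecDiff a b G}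

/-- A functor from the category `Λ` to the group `Γ`. -/
structure GroupFunctor (Γ : Type w) [Group Γ] where
  map : Λ.Mor → Γ
  map_one : ∀ v, map (Λ.one v) = 1
  map_comp : ∀ a b h, map (Λ.comp a b h) = map a * map b

variable {Λ}

/-- The cocycle `c_η` on the boundary path groupoid:
`c_η(x, p - q, y) = η(x(0, p)) η(y(0, q))⁻¹` whenever `σ^p(x) = σ^q(y)`. The definition picks some
such `p, q`; the value does not depend on the choice by `GroupFunctor.cocycle_eq`. -/
noncomputable def GroupFunctor.cocycle {Γ : Type w} [Group Γ] (η : Λ.GroupFunctor Γ)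
    (g : Λ.BPGroupoid) : Γ :=
  η.map (g.rng.initial g.mem.choose g.mem.choose_spec.choose_spec.choose) *
    (η.map (g.src.initial g.mem.choose_spec.choose
      g.mem.choose_spec.choose_spec.choose_spec.choose))⁻¹

theorem GroupFunctor.initial_add {Γ : Type w} [Group Γ] (η : Λ.GroupFunctor Γ)
    {x y : Λ.BoundaryPath} {p q a P Q : Fin k → ℕ} (hP : P = p + a) (hQ : Q = q + a)
    (hp : toE p ≤ x.deg) (hq : toE q ≤ y.deg) (h : x.shift p hp = y.shift q hq)
    (hPx : toE P ≤ x.deg) (hQy : toE Q ≤ y.deg) :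
    η.map (x.initial p hp) * (η.map (y.initial q hq))⁻¹ =
      η.map (x.initial P hPx) * (η.map (y.initial Q hQy))⁻¹ := by
  subst hP; subst hQ
  have h1 : toE a ≤ (x.shift p hp).deg := BoundaryPath.le_shift_deg hPx
  have h2 : toE a ≤ (y.shift q hq).deg := BoundaryPath.le_shift_deg hQy
  have hseg : x.seg p (p + a) le_self_add hPx = y.seg q (q + a) le_self_add hQy := by
    have h3 := BoundaryPath.seg_of_eq h zero_le h1 h2
    have h4 : (x.shift p hp).seg 0 a zero_le h1 = x.seg p (p + a) le_self_add hPx :=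
      x.seg_congr (zero_add p) (add_comm a p) _ _ _ _
    have h5 : (y.shift q hq).seg 0 a zero_le h2 = y.seg q (q + a) le_self_add hQy :=
      y.seg_congr (zero_add q) (add_comm a q) _ _ _ _
    rw [← h4, ← h5, h3]
  have e1 : η.map (x.initial (p + a) hPx) =
      η.map (x.initial p hp) * η.map (x.seg p (p + a) le_self_add hPx) := by
    exact (congrArg η.map (x.seg_comp 0 p (p + a) zero_le le_self_add hp hPx)).trans
      (η.map_comp _ _ _)
  have e2 : η.map (y.initial (q + a) hQy) =
      η.map (y.initial q hq) * η.map (y.seg q (q + a) le_self_add hQy) := by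
    exact (congrArg η.map (y.seg_comp 0 q (q + a) zero_le le_self_add hq hQy)).trans
      (η.map_comp _ _ _)
  rw [e1, e2, hseg]
  group

theorem GroupFunctor.cocycle_eq {Γ : Type w} [Group Γ] (η : Λ.GroupFunctor Γ)
    (g : Λ.BPGroupoid) {p q : Fin k → ℕ} (hp : toE p ≤ g.rng.deg) (hq : toE q ≤ g.src.deg)
    (hl : toZ p - toZ q = g.lag) (h : g.rng.shift p hp = g.src.shift q hq) :
    η.cocycle g = η.map (g.rng.initial p hp) * (η.map (g.src.initial q hq))⁻¹ := by
  unfold GroupFunctor.cocycle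
  obtain ⟨hl', h'⟩ := g.mem.choose_spec.choose_spec.choose_spec.choose_spec
  have c₃ := g.mem.choose_spec.choose_spec.choose
  set p' := g.mem.choose
  set q' := g.mem.choose_spec.choose
  have hi : ∀ i, (p i : ℤ) - q i = (p' i : ℤ) - q' i := fun i =>
    congrFun (hl.trans hl'.symm) i
  have hj : toE (p ⊔ p') ≤ g.rng.deg := by
    intro i
    rcases le_total (p i) (p' i) with hi | hi
    · simpa [toE, hi] using c₃ i
    · simpa [toE, hi] using hp i
  have eP : p ⊔ p' = p + (p ⊔ p' - p) := (add_tsub_cancel_of_le le_sup_left).symm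
  have eP' : p ⊔ p' = p' + (p ⊔ p' - p') := (add_tsub_cancel_of_le le_sup_right).symm
  have eQ : q + (p ⊔ p' - p) = q' + (p ⊔ p' - p') := by
    funext i
    have := hi i
    simp only [Pi.sub_apply, Pi.add_apply, Pi.sup_apply]
    omega
  obtain ⟨hQ, -⟩ := BoundaryPath.shift_eq_add eP rfl hp hq h hj
  rw [η.initial_add eP rfl hp hq h hj hQ, η.initial_add eP' eQ _ _ h' hj hQ]

end Groupoid

section OrbitEquivalence

variable {k : ℕ} {Λ : KGraph.{u} k}

/-- `σ^m(x)` and `σ^n(x)` are defined and equal. -/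
def PeriodPair (x : Λ.BoundaryPath) (m n : Fin k → ℕ) : Prop :=
  ∃ (hm : toE m ≤ x.deg) (hn : toE n ≤ x.deg), x.shift m hm = x.shift n hn

/-- `σ^m` and `σ^n` are defined and equal on an open neighbourhood of `x`. -/
def InnerPeriodPair (x : Λ.BoundaryPath) (m n : Fin k → ℕ) : Prop :=
  ∃ U : Set Λ.BoundaryPath, IsOpen U ∧ x ∈ U ∧ ∀ y ∈ U, PeriodPair y m n

/-- The periodicity group of `x`. -/
def Per (x : Λ.BoundaryPath) : Set (Fin k → ℤ) :=
  {l | ∃ m n, PeriodPair x m n ∧ l = toZ m - toZ n}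

/-- The inner-periodicity group of `x`. -/
def IP (x : Λ.BoundaryPath) : Set (Fin k → ℤ) :=
  {l | ∃ m n, InnerPeriodPair x m n ∧ l = toZ m - toZ n}

/-- The orbit of `x`: all `y` with `σ^n(y) = σ^m(x)` for some `m`, `n`. -/
def orb (x : Λ.BoundaryPath) : Set Λ.BoundaryPath :=
  {y | ∃ (n m : Fin k → ℕ) (hn : toE n ≤ y.deg) (hm : toE m ≤ x.deg),
    y.shift n hn = x.shift m hm}

variable {k₁ k₂ : ℕ} {Λ₁ : KGraph.{u} k₁} {Λ₂ : KGraph.{v} k₂}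

def IsOrbitEquivalence (h : Λ₁.BoundaryPath ≃ₜ Λ₂.BoundaryPath) : Prop :=
  ∀ x, h '' orb x = orb (h x)

/-- One half of a family of continuous cocycles for an orbit equivalence `h`: continuous maps
`f m, g m : ∂Λ₁^{≥ m} → ℕ ^ k₂` with `σ^{f_m(x)}(h(σ^m(x))) = σ^{g_m(x)}(h(x))` that satisfy the
cocycle identity. The other half (the maps `i_n, j_n`) is a term of this type for `h⁻¹`. -/
structure CocycleHalf (h : Λ₁.BoundaryPath → Λ₂.BoundaryPath) where
  f : (m : Fin k₁ → ℕ) → {x : Λ₁.BoundaryPath // toE m ≤ x.deg} → Fin k₂ → ℕ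
  g : (m : Fin k₁ → ℕ) → {x : Λ₁.BoundaryPath // toE m ≤ x.deg} → Fin k₂ → ℕ
  continuous_f : ∀ m, Continuous (f m)
  continuous_g : ∀ m, Continuous (g m)
  f_le : ∀ m x, toE (f m x) ≤ (h (x.1.shift m x.2)).deg
  g_le : ∀ m x, toE (g m x) ≤ (h x.1).deg
  shift_eq : ∀ m x,
    (h (x.1.shift m x.2)).shift (f m x) (f_le m x) = (h x.1).shift (g m x) (g_le m x)
  cocycle : ∀ (m n : Fin k₁ → ℕ) (x : Λ₁.BoundaryPath) (hx : toE (m + n) ≤ x.deg),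
    toZ (g (m + n) ⟨x, hx⟩) - toZ (f (m + n) ⟨x, hx⟩) =
      toZ (g m ⟨x, toE_le_left hx⟩) - toZ (f m ⟨x, toE_le_left hx⟩) +
        toZ (g n ⟨x.shift m (toE_le_left hx), BoundaryPath.le_shift_deg hx⟩) -
        toZ (f n ⟨x.shift m (toE_le_left hx), BoundaryPath.le_shift_deg hx⟩)

namespace CocycleHalf

variable {h : Λ₁.BoundaryPath → Λ₂.BoundaryPath}

/-- `{g_m(x) - f_m(x) - g_n(x) + f_n(x) : σ^m(x) = σ^n(x)} = Per(h(x))` for all `x`. -/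
def PeriodPreserving (F : CocycleHalf h) : Prop :=
  ∀ x : Λ₁.BoundaryPath,
    {l : Fin k₂ → ℤ | ∃ (m n : Fin k₁ → ℕ) (hm : toE m ≤ x.deg) (hn : toE n ≤ x.deg),
      PeriodPair x m n ∧
        l = toZ (F.g m ⟨x, hm⟩) - toZ (F.f m ⟨x, hm⟩) - toZ (F.g n ⟨x, hn⟩)
          + toZ (F.f n ⟨x, hn⟩)} = Per (h x)

/-- `{g_m(x) - f_m(x) - g_n(x) + f_n(x) : σ^m = σ^n near x} = IP(h(x))` for all `x`. -/
def InnerPeriodPreserving (F : CocycleHalf h) : Prop :=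
  ∀ x : Λ₁.BoundaryPath,
    {l : Fin k₂ → ℤ | ∃ (m n : Fin k₁ → ℕ) (hm : toE m ≤ x.deg) (hn : toE n ≤ x.deg),
      InnerPeriodPair x m n ∧
        l = toZ (F.g m ⟨x, hm⟩) - toZ (F.f m ⟨x, hm⟩) - toZ (F.g n ⟨x, hn⟩)
          + toZ (F.f n ⟨x, hn⟩)} = IP (h x)

/-- `η₁(x(0, m)) = η₂(h(x)(0, g_m(x))) η₂(h(σ^m(x))(0, f_m(x)))⁻¹` for all `m` and `x`. -/
def Graded {Γ : Type w} [Group Γ] (F : CocycleHalf h) (η₁ : Λ₁.GroupFunctor Γ)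
    (η₂ : Λ₂.GroupFunctor Γ) : Prop :=
  ∀ (m : Fin k₁ → ℕ) (x : Λ₁.BoundaryPath) (hx : toE m ≤ x.deg),
    η₁.map (x.initial m hx) =
      η₂.map ((h x).initial (F.g m ⟨x, hx⟩) (F.g_le m ⟨x, hx⟩)) *
        (η₂.map ((h (x.shift m hx)).initial (F.f m ⟨x, hx⟩) (F.f_le m ⟨x, hx⟩)))⁻¹

end CocycleHalf

/-- A family of continuous cocycles `(f_m, g_m, i_n, j_n)` for `h`. -/
structure CocycleFamily (h : Λ₁.BoundaryPath ≃ₜ Λ₂.BoundaryPath) where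
  fg : CocycleHalf h
  ij : CocycleHalf h.symm

namespace CocycleFamily

variable {h : Λ₁.BoundaryPath ≃ₜ Λ₂.BoundaryPath}

def Graded {Γ : Type w} [Group Γ] (F : CocycleFamily h) (η₁ : Λ₁.GroupFunctor Γ)
    (η₂ : Λ₂.GroupFunctor Γ) : Prop :=
  F.fg.Graded η₁ η₂ ∧ F.ij.Graded η₂ η₁

def PeriodPreserving (F : CocycleFamily h) : Prop :=
  F.fg.PeriodPreserving ∧ F.ij.PeriodPreserving

def InnerPeriodPreserving (F : CocycleFamily h) : Prop :=
  F.fg.InnerPeriodPreserving ∧ F.ij.InnerPeriodPreserving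

end CocycleFamily

/-- `φ` is an isomorphism of topological groupoids: a homeomorphism that preserves composability
and products. -/
def IsGroupoidIso (φ : Λ₁.BPGroupoid ≃ₜ Λ₂.BPGroupoid) : Prop :=
  ∀ (a b : Λ₁.BPGroupoid) (hab : a.src = b.rng),
    ∃ hab' : (φ a).src = (φ b).rng, φ (a.mul b hab) = (φ a).mul (φ b) hab'

end OrbitEquivalence

end KGraph

/-! An isomorphism over `h` and a family of cocycles carry the same data. A groupoid element `(x, m
- n, y)` with `σ^m(x) = σ^n(y)` is the product of `(x, m, σ^m(x))` and `(y, n, σ^n(y))⁻¹`, so a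
homomorphism over `h` is determined by the lags of the images of the `(x, m, σ^m(x))`; these are the
differences `g_m(x) - f_m(x)`. Conversely the cocycle identity makes these differences define a
homomorphism `CocycleHalf.map`, continuous because `f` and `g` are locally constant, and gradedness
is its compatibility with the cocycles `c_η`. To recover `f` and `g` from a homomorphism
(`exists_cocycleHalf`), a basic bisection around each image is chosen in a locally constant way;
this is possible because there are countably many of them and they are clopen.

The homomorphism need not be bijective, since `(i, j)` need not invert `(f, g)`. Period preservation
says exactly that `Per(x) → Per(h(x))` is surjective, and likewise for `(i, j)`. The composite is a
surjective endomorphism of a subgroup of `ℤ^k`, hence injective by Noetherianity. So `map` is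
injective on isotropy and therefore injective; together with orbit equivalence it is bijective. This
gives 2 → 1.

For 1 → 3, the two homomorphisms are mutually inverse and each carries inner periods to inner
periods. For 3 → 2, if `g` is isotropy at `h(x)`, then `F(F'(g))` and `g` differ by an inner period
of `h(x)`, since nearby elements keep the same pair of lags; condition 3 lifts that difference to
`x`, and correcting `F'(g)` by the lift gives a preimage of `g`.

Finite alignment enters through the topology: basic bisections are clopen and homeomorphic to their
ranges (`nhds_eq`), and the range map is open (`isOpenMap_rng`). -/

namespace KGraph

/-! ### Unique factorisation, common extensions and exhaustive sets. -/

section Segments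

variable {k : ℕ} {Λ : KGraph.{u} k}

theorem comp_congr {a a' b b' : Λ.Mor} (ha : a = a') (hb : b = b') (h : Λ.s a = Λ.r b)
    (h' : Λ.s a' = Λ.r b') : Λ.comp a b h = Λ.comp a' b' h' := by
  subst ha; subst hb; rfl

/-- Factorisations with prescribed degree are unique. -/
theorem comp_inj {a a' b b' : Λ.Mor} {h : Λ.s a = Λ.r b} {h' : Λ.s a' = Λ.r b'}
    (hc : Λ.comp a b h = Λ.comp a' b' h') (hd : Λ.d a = Λ.d a') : a = a' ∧ b = b' := by
  have h1 : Λ.d a + Λ.d b = Λ.d a + Λ.d b' := by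
    rw [← Λ.d_comp a b h, hc, Λ.d_comp, hd]
  have h2 := add_left_cancel h1
  have := (Λ.factorisation (Λ.comp a b h) (Λ.d a) (Λ.d b) (Λ.d_comp a b h)).unique
    (y₁ := (a, b)) (y₂ := (a', b')) ⟨rfl, rfl, h, rfl⟩ ⟨hd.symm, h2.symm, h', hc.symm⟩
  exact Prod.mk.inj this

theorem comp_left_cancel {a b b' : Λ.Mor} {h : Λ.s a = Λ.r b} {h' : Λ.s a = Λ.r b'}
    (hc : Λ.comp a b h = Λ.comp a b' h') : b = b' :=
  (comp_inj hc rfl).2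

theorem isInitial_comp (a b : Λ.Mor) (h : Λ.s a = Λ.r b) : Λ.IsInitial a (Λ.comp a b h) :=
  ⟨b, h, rfl⟩

theorem IsInitial.refl (a : Λ.Mor) : Λ.IsInitial a a :=
  ⟨_, (Λ.r_one _).symm, Λ.comp_one a⟩

theorem IsInitial.trans {a b c : Λ.Mor} (hab : Λ.IsInitial a b) (hbc : Λ.IsInitial b c) :
    Λ.IsInitial a c := by
  obtain ⟨e, h, rfl⟩ := hab
  obtain ⟨f, h', rfl⟩ := hbc
  exact ⟨_, _, (Λ.assoc a e f h ((Λ.s_comp a e h).symm.trans h')).symm⟩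

theorem IsInitial.d_le {a b : Λ.Mor} (hab : Λ.IsInitial a b) : Λ.d a ≤ Λ.d b := by
  obtain ⟨e, h, rfl⟩ := hab
  rw [Λ.d_comp]
  exact le_self_add

theorem exists_isInitial (c : Λ.Mor) {m : Fin k → ℕ} (hm : m ≤ Λ.d c) :
    ∃ b, Λ.d b = m ∧ Λ.IsInitial b c := by
  obtain ⟨p, ⟨h1, -, h, h3⟩, -⟩ :=
    Λ.factorisation c m (Λ.d c - m) (add_tsub_cancel_of_le hm).symm
  exact ⟨p.1, h1, p.2, h, h3⟩

theorem IsInitial.eq_of_d_eq {a b c : Λ.Mor} (ha : Λ.IsInitial a c) (hb : Λ.IsInitial b c)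
    (hd : Λ.d a = Λ.d b) : a = b := by
  obtain ⟨e, h, rfl⟩ := ha
  obtain ⟨f, h', hf⟩ := hb
  exact (comp_inj hf hd.symm).1.symm

theorem IsInitial.of_d_le {a b c : Λ.Mor} (ha : Λ.IsInitial a c) (hb : Λ.IsInitial b c)
    (hd : Λ.d a ≤ Λ.d b) : Λ.IsInitial a b := by
  obtain ⟨e, he, h⟩ := exists_isInitial b hd
  rwa [ha.eq_of_d_eq (h.trans hb) he.symm]

theorem IsInitial.comp_left {a b : Λ.Mor} (hab : Λ.IsInitial a b) (c : Λ.Mor)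
    (h : Λ.s c = Λ.r a) (h' : Λ.s c = Λ.r b) :
    Λ.IsInitial (Λ.comp c a h) (Λ.comp c b h') := by
  obtain ⟨e, he, rfl⟩ := hab
  exact ⟨e, _, Λ.assoc c a e h he⟩

theorem IsInitial.of_comp_left {a b c : Λ.Mor} {h : Λ.s c = Λ.r a} {h' : Λ.s c = Λ.r b}
    (hab : Λ.IsInitial (Λ.comp c a h) (Λ.comp c b h')) : Λ.IsInitial a b := by
  obtain ⟨e, he, hc⟩ := hab
  rw [Λ.assoc c a e h ((Λ.s_comp c a h).symm.trans he)] at hc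
  exact ⟨e, _, comp_left_cancel hc⟩

/-- A common extension of `a` and `b` extends a minimal one. -/
theorem exists_mem_minExt {a b c : Λ.Mor} (ha : Λ.IsInitial a c) (hb : Λ.IsInitial b c) :
    ∃ p ∈ Λ.minExt a b, ∃ h : Λ.s a = Λ.r p.1, Λ.IsInitial (Λ.comp a p.1 h) c := by
  obtain ⟨e, he, hec⟩ := exists_isInitial c (sup_le ha.d_le hb.d_le)
  obtain ⟨x, hx, hxe⟩ := ha.of_d_le hec (he ▸ le_sup_left)
  obtain ⟨y, hy, hye⟩ := hb.of_d_le hec (he ▸ le_sup_right)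
  refine ⟨(x, y), ⟨hx, hy, hxe.trans hye.symm, ?_, isInitial_comp _ _ _, ?_⟩, hx, hxe ▸ hec⟩
  · rw [hxe, he]
  · exact ⟨y, hy, hye.trans hxe.symm⟩

theorem minExt_nonempty {a b c : Λ.Mor} (ha : Λ.IsInitial a c) (hb : Λ.IsInitial b c) :
    (Λ.minExt a b).Nonempty :=
  let ⟨p, hp, _⟩ := exists_mem_minExt ha hb
  ⟨p, hp⟩

theorem FinitelyAligned.finite_ext (hΛ : Λ.FinitelyAligned) (a : Λ.Mor) {E : Set Λ.Mor}
    (hE : E.Finite) : {x | ∃ b ∈ E, ∃ y, (x, y) ∈ Λ.minExt a b}.Finite := by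
  refine (hE.biUnion fun b _ => (hΛ a b).image Prod.fst).subset ?_
  rintro x ⟨b, hb, y, h⟩
  exact Set.mem_biUnion hb ⟨_, h, rfl⟩

/-- For `c` in `s(a)Λ`, some `b ∈ E` has a common extension with `ac`. It extends a minimal common
extension `ap` of `a` and `b`, and cancelling `a` leaves a common extension of `c` and `p`. This is
what allows a prefix to be attached to a boundary path. -/
theorem Exhaustive.ext {a : Λ.Mor} {E : Set Λ.Mor} (hE : Λ.Exhaustive (Λ.r a) E) :
    Λ.Exhaustive (Λ.s a) {x | ∃ b ∈ E, ∃ y, (x, y) ∈ Λ.minExt a b} := by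
  refine ⟨?_, ?_⟩
  · rintro x ⟨b, -, y, h, -⟩
    exact h.symm
  · intro c hc
    obtain ⟨b, hb, ⟨x, y⟩, hx, hy, hxy, -⟩ := hE.2 (Λ.comp a c hc.symm) (Λ.r_comp _ _ _)
    have hx' : Λ.s c = Λ.r x := (Λ.s_comp _ _ _).symm.trans hx
    have e := Λ.assoc a c x hc.symm hx'
    obtain ⟨⟨p, q⟩, hp, h, hi⟩ := exists_mem_minExt (a := a) (b := b)
      (c := Λ.comp b y hy) ⟨_, _, e.symm.trans hxy⟩ (isInitial_comp _ _ _)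
    refine ⟨p, ⟨b, hb, q, hp⟩, ?_⟩
    have hi' : Λ.IsInitial p (Λ.comp c x hx') := by
      refine IsInitial.of_comp_left (h := h) (h' := hc.symm.trans (Λ.r_comp _ _ _).symm) ?_
      rw [← e]
      exact hxy ▸ hi
    exact minExt_nonempty (isInitial_comp _ _ _) hi'

end Segments

/-! ### Boundary paths: initial segments, tails and concatenation. -/

section Paths

variable {k : ℕ} {Λ : KGraph.{u} k}

theorem toE_sup_le {m n : Fin k → ℕ} {e : Fin k → ℕ∞} (hm : toE m ≤ e) (hn : toE n ≤ e) :
    toE (m ⊔ n) ≤ e := by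
  intro i
  rcases le_total (m i) (n i) with hi | hi
  · simpa [toE, hi] using hn i
  · simpa [toE, hi] using hm i

theorem toE_zero_le (e : Fin k → ℕ∞) : toE (0 : Fin k → ℕ) ≤ e := fun _ => zero_le

namespace BoundaryPath

theorem d_initial (x : Λ.BoundaryPath) (m : Fin k → ℕ) (hm : toE m ≤ x.deg) :
    Λ.d (x.initial m hm) = m := by
  have := x.d_seg 0 m zero_le hm
  rwa [zero_add] at this

theorem s_initial (x : Λ.BoundaryPath) (m : Fin k → ℕ) (hm : toE m ≤ x.deg) :
    Λ.s (x.initial m hm) = x.vert m hm :=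
  x.s_seg _ _ _ _

theorem r_initial (x : Λ.BoundaryPath) (m : Fin k → ℕ) (hm : toE m ≤ x.deg) :
    Λ.r (x.initial m hm) = x.vert 0 (toE_zero_le _) :=
  x.r_seg _ _ _ _ _

theorem initial_congr (x : Λ.BoundaryPath) {m n : Fin k → ℕ} (h : m = n) (hm : toE m ≤ x.deg)
    (hn : toE n ≤ x.deg) : x.initial m hm = x.initial n hn := by
  subst h; rfl

theorem vert_congr (x : Λ.BoundaryPath) {m n : Fin k → ℕ} (h : m = n) (hm : toE m ≤ x.deg)
    (hn : toE n ≤ x.deg) : x.vert m hm = x.vert n hn := by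
  subst h; rfl

theorem initial_comp_seg (x : Λ.BoundaryPath) {m n : Fin k → ℕ} (h : m ≤ n) (hm : toE m ≤ x.deg)
    (hn : toE n ≤ x.deg) :
    x.initial n hn = Λ.comp (x.initial m hm) (x.seg m n h hn)
      ((x.s_initial m hm).trans (x.r_seg m n h hn hm).symm) :=
  x.seg_comp 0 m n zero_le h hm hn

theorem initial_isInitial (x : Λ.BoundaryPath) {m n : Fin k → ℕ} (h : m ≤ n)
    (hm : toE m ≤ x.deg) (hn : toE n ≤ x.deg) :
    Λ.IsInitial (x.initial m hm) (x.initial n hn) :=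
  ⟨_, _, (x.initial_comp_seg h hm hn).symm⟩

theorem shift_initial (x : Λ.BoundaryPath) {m n : Fin k → ℕ} (hm : toE m ≤ x.deg)
    (hn : toE n ≤ (x.shift m hm).deg) (h : toE (m + n) ≤ x.deg) :
    (x.shift m hm).initial n hn = x.seg m (m + n) le_self_add h :=
  x.seg_congr (zero_add m) (add_comm n m) _ _ _ _

theorem mem_cyl_initial (x : Λ.BoundaryPath) (m : Fin k → ℕ) (hm : toE m ≤ x.deg) :
    x ∈ Λ.cyl (x.initial m hm) :=
  ⟨(x.d_initial m hm).symm ▸ hm, x.initial_congr (x.d_initial m hm) _ _⟩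

end BoundaryPath

theorem mem_cyl_iff_isInitial {x : Λ.BoundaryPath} {a : Λ.Mor} {n : Fin k → ℕ}
    (hn : toE n ≤ x.deg) (h : Λ.d a ≤ n) : x ∈ Λ.cyl a ↔ Λ.IsInitial a (x.initial n hn) := by
  constructor
  · rintro ⟨ha, hi⟩
    conv_lhs => rw [← hi]
    exact x.initial_isInitial h ha hn
  · intro hi
    have ha : toE (Λ.d a) ≤ x.deg := (toE_mono h).trans hn
    exact ⟨ha, (x.initial_isInitial h ha hn).eq_of_d_eq hi (x.d_initial _ _)⟩

theorem cyl_of_isInitial {x : Λ.BoundaryPath} {a b : Λ.Mor} (h : Λ.IsInitial a b)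
    (hx : x ∈ Λ.cyl b) : x ∈ Λ.cyl a := by
  obtain ⟨hb, hi⟩ := hx
  rw [mem_cyl_iff_isInitial hb h.d_le, hi]
  exact h

theorem eq_of_mem_cyl {x : Λ.BoundaryPath} {a b : Λ.Mor} (ha : x ∈ Λ.cyl a) (hb : x ∈ Λ.cyl b)
    (h : Λ.d a = Λ.d b) : a = b := by
  obtain ⟨ha, ha'⟩ := ha
  obtain ⟨hb, hb'⟩ := hb
  exact ha'.symm.trans ((x.initial_congr h _ _).trans hb')

theorem isInitial_of_mem_cyl {x : Λ.BoundaryPath} {a b : Λ.Mor} (ha : x ∈ Λ.cyl a)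
    (hb : x ∈ Λ.cyl b) (h : Λ.d a ≤ Λ.d b) : Λ.IsInitial a b := by
  obtain ⟨hb', e⟩ := hb
  rw [← e]
  exact (mem_cyl_iff_isInitial _ h).1 ha

theorem s_eq_vert {x : Λ.BoundaryPath} {a : Λ.Mor} (ha : x ∈ Λ.cyl a)
    (h : toE (Λ.d a) ≤ x.deg) : Λ.s a = x.vert (Λ.d a) h := by
  obtain ⟨h', hi⟩ := ha
  rw [← x.s_initial (Λ.d a) h, hi]

theorem mem_cyl_comp {x : Λ.BoundaryPath} {a b : Λ.Mor} (h : Λ.s a = Λ.r b) :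
    x ∈ Λ.cyl (Λ.comp a b h) ↔
      x ∈ Λ.cyl a ∧ ∃ ha : toE (Λ.d a) ≤ x.deg, x.shift (Λ.d a) ha ∈ Λ.cyl b := by
  constructor
  · intro hx
    have hxa := cyl_of_isInitial (isInitial_comp a b h) hx
    obtain ⟨hab, hi⟩ := hx
    have hab' : toE (Λ.d a + Λ.d b) ≤ x.deg := by rwa [Λ.d_comp] at hab
    refine ⟨hxa, hxa.1, BoundaryPath.le_shift_deg hab', ?_⟩
    rw [x.shift_initial _ _ hab']
    rw [x.initial_congr (Λ.d_comp a b h) _ hab', x.initial_comp_seg le_self_add hxa.1 hab'] at hi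
    exact (comp_inj hi (x.d_initial _ _)).2
  · rintro ⟨⟨ha, hia⟩, ha', hb, hib⟩
    have hab : toE (Λ.d a + Λ.d b) ≤ x.deg := by
      rw [add_comm]; exact toE_add_le ha hb
    have hab' : toE (Λ.d (Λ.comp a b h)) ≤ x.deg := by rwa [Λ.d_comp]
    rw [x.shift_initial _ _ hab] at hib
    refine ⟨hab', ?_⟩
    rw [x.initial_congr (Λ.d_comp a b h) _ hab, x.initial_comp_seg le_self_add ha hab]
    exact comp_congr hia hib _ _

/-- Boundary paths with the same initial segments are equal. -/
theorem eq_of_forall_mem_cyl {x y : Λ.BoundaryPath} (h : ∀ a, x ∈ Λ.cyl a ↔ y ∈ Λ.cyl a) :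
    x = y := by
  have key : ∀ {x y : Λ.BoundaryPath}, (∀ a, x ∈ Λ.cyl a → y ∈ Λ.cyl a) → x.deg ≤ y.deg := by
    intro x y h i
    refine ENat.forall_natCast_le_iff_le.1 fun m hm => ?_
    -- The degree may be infinite, so it is tested one coordinate at a time on the finite degrees `m
    -- e_i`.
    have hx : toE (Pi.single i m : Fin k → ℕ) ≤ x.deg := by
      intro j
      by_cases hj : j = i
      · subst hj; simpa [toE] using hm
      · simp [toE, hj]
    obtain ⟨hy, -⟩ := h _ (x.mem_cyl_initial _ hx)
    rw [x.d_initial] at hy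
    simpa [toE] using hy i
  have hd : x.deg = y.deg := le_antisymm (key fun a => (h a).1) (key fun a => (h a).2)
  have hi : ∀ n hx hy, x.initial n hx = y.initial n hy := fun n hx hy =>
    eq_of_mem_cyl ((h _).1 (x.mem_cyl_initial n hx)) (y.mem_cyl_initial n hy)
      ((x.d_initial _ _).trans (y.d_initial _ _).symm)
  refine BoundaryPath.ext_seg hd fun p q hpq hx hy => ?_
  have hxp := (toE_mono hpq).trans hx
  have hyp := (toE_mono hpq).trans hy
  have := hi q hx hy
  rw [x.initial_comp_seg hpq hxp hx, y.initial_comp_seg hpq hyp hy] at this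
  exact (comp_inj this ((x.d_initial _ _).trans (y.d_initial _ _).symm)).2

/-- `σ^p(x)` and `σ^q(y)` are defined and equal. -/
def ShiftEq (x : Λ.BoundaryPath) (p : Fin k → ℕ) (y : Λ.BoundaryPath) (q : Fin k → ℕ) : Prop :=
  ∃ (hp : toE p ≤ x.deg) (hq : toE q ≤ y.deg), x.shift p hp = y.shift q hq

namespace ShiftEq

variable {x y z : Λ.BoundaryPath} {p q p' q' a : Fin k → ℕ}

theorem symm (h : ShiftEq x p y q) : ShiftEq y q x p :=
  ⟨h.2.1, h.1, h.2.2.symm⟩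

theorem add (h : ShiftEq x p y q) (ha : toE (p + a) ≤ x.deg) : ShiftEq x (p + a) y (q + a) :=
  let ⟨hp, hq, e⟩ := h
  ⟨ha, BoundaryPath.shift_eq_add rfl rfl hp hq e ha⟩

theorem trans_same (h : ShiftEq x p y q) (h' : ShiftEq y q z q') : ShiftEq x p z q' :=
  ⟨h.1, h'.2.1, h.2.2.trans h'.2.2⟩

/-- Both relations are pushed to the degree `q ⊔ p'` on the middle path `y`. -/
theorem trans (h : ShiftEq x p y q) (h' : ShiftEq y p' z q') :
    ShiftEq x (p + (q ⊔ p' - q)) z (q' + (q ⊔ p' - p')) := by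
  have hj := toE_sup_le h.2.1 h'.1
  have e₁ : q + (q ⊔ p' - q) = q ⊔ p' := add_tsub_cancel_of_le le_sup_left
  have e₂ : p' + (q ⊔ p' - p') = q ⊔ p' := add_tsub_cancel_of_le le_sup_right
  have h1 := h.symm.add (a := q ⊔ p' - q) (by rwa [e₁])
  have h2 := h'.add (a := q ⊔ p' - p') (by rwa [e₂])
  rw [e₁] at h1
  rw [e₂] at h2
  exact h1.symm.trans_same h2

theorem add_left_le (h : ShiftEq x p y q) (hP : p ≤ p') (hp' : toE p' ≤ x.deg) :
    ShiftEq x p' y (q + (p' - p)) := by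
  have e : p + (p' - p) = p' := add_tsub_cancel_of_le hP
  have := h.add (a := p' - p) (by rwa [e])
  rwa [e] at this

end ShiftEq

theorem shiftEq_shift {x : Λ.BoundaryPath} {m n : Fin k → ℕ} (h : toE (m + n) ≤ x.deg)
    (hm : toE m ≤ x.deg) : ShiftEq x (m + n) (x.shift m hm) n :=
  ⟨h, BoundaryPath.le_shift_deg h, (x.shift_shift rfl h hm _).symm⟩

theorem shiftEq_shift_zero {x : Λ.BoundaryPath} {m : Fin k → ℕ}
    (hm : toE m ≤ x.deg) : ShiftEq x m (x.shift m hm) 0 :=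
  shiftEq_shift (n := 0) (by simpa using hm) hm

theorem mem_cyl_comp_of_shiftEq {x y : Λ.BoundaryPath} {a b c : Λ.Mor} {h : Λ.s a = Λ.r c}
    {h' : Λ.s b = Λ.r c} (hxy : ShiftEq x (Λ.d a) y (Λ.d b)) (hy : y ∈ Λ.cyl b)
    (hx : x ∈ Λ.cyl (Λ.comp a c h)) : y ∈ Λ.cyl (Λ.comp b c h') := by
  obtain ⟨hp, hq, e⟩ := hxy
  obtain ⟨_, _, hc⟩ := (mem_cyl_comp h).1 hx
  exact (mem_cyl_comp h').2 ⟨hy, hq, e ▸ hc⟩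

/-- A boundary path is determined by an initial segment and the remaining tail. -/
theorem eq_of_shiftEq {x y : Λ.BoundaryPath} {a : Λ.Mor} (hx : x ∈ Λ.cyl a) (hy : y ∈ Λ.cyl a)
    (h : ShiftEq x (Λ.d a) y (Λ.d a)) : x = y := by
  have key : ∀ {x y : Λ.BoundaryPath}, x ∈ Λ.cyl a → y ∈ Λ.cyl a →
      ShiftEq x (Λ.d a) y (Λ.d a) → ∀ c, x ∈ Λ.cyl c → y ∈ Λ.cyl c := by
    intro x y hx hy h c hc
    -- The segment `c` of `x` is enlarged to degree `d(a) ⊔ d(c)`; there it has the form `ae`, which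
    -- passes to `y`.
    have hj := toE_sup_le hx.1 hc.1
    obtain ⟨e, he, hi⟩ := (mem_cyl_iff_isInitial hj le_sup_left).1 hx
    have hci := (mem_cyl_iff_isInitial hj le_sup_right).1 hc
    refine cyl_of_isInitial hci ?_
    clear hci
    have hxj := x.mem_cyl_initial _ hj
    rw [← hi] at hxj ⊢
    exact mem_cyl_comp_of_shiftEq h hy hxj
  exact eq_of_forall_mem_cyl fun c => ⟨key hx hy h c, key hy hx h.symm c⟩

namespace BoundaryPath

/-- The boundary path with given initial segments. -/
noncomputable def ofInitial (deg : Fin k → ℕ∞) (I : (q : Fin k → ℕ) → toE q ≤ deg → Λ.Mor)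
    (hd : ∀ q hq, Λ.d (I q hq) = q) (hI : ∀ p q hp hq, p ≤ q → Λ.IsInitial (I p hp) (I q hq))
    (hb : ∀ n hn (E : Set Λ.Mor), E.Finite → Λ.Exhaustive (Λ.s (I n hn)) E →
      ∃ c ∈ E, ∃ h : toE (n + Λ.d c) ≤ deg, ∃ h', I (n + Λ.d c) h = Λ.comp (I n hn) c h') :
    Λ.BoundaryPath where
  deg := deg
  vert p hp := Λ.s (I p hp)
  seg p q hpq hq := (hI p q ((toE_mono hpq).trans hq) hq hpq).choose
  r_seg p q hpq hq hp := (hI p q ((toE_mono hpq).trans hq) hq hpq).choose_spec.choose.symm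
  s_seg p q hpq hq := by
    have h := (hI p q ((toE_mono hpq).trans hq) hq hpq).choose_spec.choose_spec
    rw [← Λ.s_comp _ _ (hI p q ((toE_mono hpq).trans hq) hq hpq).choose_spec.choose, h]
  seg_self p hp := by
    have h := (hI p p hp hp le_rfl).choose_spec.choose_spec
    exact comp_left_cancel (h.trans (Λ.comp_one _).symm)
  seg_comp p q t hpq hqt hq ht := by
    have h₁ := (hI p q ((toE_mono hpq).trans hq) hq hpq).choose_spec.choose_spec
    have h₂ := (hI q t hq ht hqt).choose_spec.choose_spec
    have h₃ := (hI p t ((toE_mono (hpq.trans hqt)).trans ht) ht (hpq.trans hqt)).choose_spec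
    obtain ⟨h₃, h₃'⟩ := h₃
    have h₄ := (hI p q ((toE_mono hpq).trans hq) hq hpq).choose_spec.choose
    refine comp_left_cancel (h' := h₄.trans (Λ.r_comp _ _ _).symm) (h₃'.trans ?_)
    refine Eq.trans ?_ (Λ.assoc _ _ _ h₄ _)
    exact h₂.symm.trans (comp_congr h₁.symm rfl _ _)
  d_seg p q hpq hq := by
    obtain ⟨h, h'⟩ := (hI p q ((toE_mono hpq).trans hq) hq hpq).choose_spec
    have := congrArg Λ.d h'
    rwa [Λ.d_comp, hd, hd] at this
  boundary n hn E hE hex := by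
    obtain ⟨c, hc, h, h', e⟩ := hb n hn E hE hex
    obtain ⟨h₁, h₂⟩ := (hI n (n + Λ.d c) ((toE_mono le_self_add).trans h) h
      le_self_add).choose_spec
    exact ⟨c, hc, h, comp_left_cancel (h₂.trans e)⟩

theorem ofInitial_initial {deg : Fin k → ℕ∞} {I : (q : Fin k → ℕ) → toE q ≤ deg → Λ.Mor}
    {hd hI hb} (q : Fin k → ℕ) (hq : toE q ≤ deg) :
    (ofInitial (Λ := Λ) deg I hd hI hb).initial q hq = I q hq := by
  obtain ⟨h, h'⟩ := (hI 0 q (toE_zero_le _) hq zero_le).choose_spec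
  refine (IsInitial.eq_of_d_eq (c := I q hq) ?_ (IsInitial.refl _) ?_)
  · have h0 : I 0 (toE_zero_le _) = Λ.one (Λ.r (I q hq)) := by
      have hi : Λ.IsInitial (Λ.one (Λ.r (I q hq))) (I q hq) := ⟨_, _, Λ.one_comp _⟩
      exact (hI 0 q (toE_zero_le _) hq zero_le).eq_of_d_eq hi (by rw [hd, Λ.d_one])
    refine ⟨_, (Λ.r_one _).symm, ?_⟩
    rw [Λ.comp_one]
    have hr : Λ.r (hI 0 q (toE_zero_le _) hq zero_le).choose = Λ.r (I q hq) := by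
      rw [← h, h0, Λ.s_one]
    refine (Λ.one_comp _).symm.trans (Eq.trans ?_ h')
    exact comp_congr (by rw [h0]; exact congrArg _ hr) rfl _ _
  · exact (d_initial _ _ _).trans (hd _ _).symm

end BoundaryPath

/-- Every boundary path with range `s(a)` is a tail of one that begins with `a`. -/
theorem FinitelyAligned.exists_concat (hΛ : Λ.FinitelyAligned) (a : Λ.Mor) (y : Λ.BoundaryPath)
    (hy : Λ.s a = y.vert 0 (toE_zero_le _)) :
    ∃ x ∈ Λ.cyl a, ∃ ha : toE (Λ.d a) ≤ x.deg, x.shift (Λ.d a) ha = y := by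
  -- The segment `x(0, q)` will be the initial segment of degree `q` of `a y(0, q ⊔ d(a) - d(a))`,
  -- which has degree `q ⊔ d(a)`.
  have hle : ∀ q, toE q ≤ y.deg + toE (Λ.d a) → toE (q ⊔ Λ.d a - Λ.d a) ≤ y.deg := by
    intro q hq i
    have h1 : (q i : ℕ∞) ≤ y.deg i + (Λ.d a i : ℕ∞) := hq i
    have h2 : (((q ⊔ Λ.d a - Λ.d a) i : ℕ) : ℕ∞) = (q i : ℕ∞) - (Λ.d a i : ℕ∞) := by
      simp only [Pi.sub_apply, Pi.sup_apply, ← ENat.natCast_sub]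
      congr 1
      omega
    change (((q ⊔ Λ.d a - Λ.d a) i : ℕ) : ℕ∞) ≤ y.deg i
    rw [h2]
    exact tsub_le_iff_right.2 h1
  have hge : ∀ q, toE q ≤ y.deg → toE (q + Λ.d a) ≤ y.deg + toE (Λ.d a) := by
    intro q hq i
    have := add_le_add_left (hq i) (Λ.d a i : ℕ∞)
    simpa [toE] using this
  have hs : ∀ q hq, Λ.s a = Λ.r (y.initial q hq) := fun q hq => hy.trans (y.r_initial q hq).symm
  let J : (q : Fin k → ℕ) → toE q ≤ y.deg → Λ.Mor := fun q hq =>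
    Λ.comp a (y.initial q hq) (hs q hq)
  have hdJ : ∀ q hq, Λ.d (J q hq) = q + Λ.d a := fun q hq => by
    rw [Λ.d_comp, y.d_initial, add_comm]
  have hJ : ∀ p q hp hq, p ≤ q → Λ.IsInitial (J p hp) (J q hq) := fun p q hp hq h =>
    (y.initial_isInitial h hp hq).comp_left _ _ _
  have hex : ∀ q (hq : toE q ≤ y.deg + toE (Λ.d a)),
      ∃ b, Λ.d b = q ∧ Λ.IsInitial b (J _ (hle q hq)) := fun q hq =>
    exists_isInitial _ (by rw [hdJ, tsub_add_cancel_of_le le_sup_right]; exact le_sup_left)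
  choose I hdI hI using hex
  have hmono : ∀ p q, p ≤ q → p ⊔ Λ.d a - Λ.d a ≤ q ⊔ Λ.d a - Λ.d a := fun p q h =>
    tsub_le_tsub_right (sup_le_sup_right h _) _
  have hII : ∀ p q hp hq, p ≤ q → Λ.IsInitial (I p hp) (I q hq) := fun p q hp hq h =>
    ((hI p hp).trans (hJ _ _ _ _ (hmono p q h))).of_d_le (hI q hq) (by rwa [hdI, hdI])
  have hIJ : ∀ q hq hq', I (q + Λ.d a) hq' = J q hq := by
    intro q hq hq'
    refine (hI _ hq').eq_of_d_eq ?_ (by rw [hdI, hdJ])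
    have e : (q + Λ.d a) ⊔ Λ.d a - Λ.d a = q := by
      rw [sup_eq_left.2 le_add_self, add_tsub_cancel_right]
    exact hJ _ _ _ _ e.ge
  have hb : ∀ n hn (E : Set Λ.Mor), E.Finite → Λ.Exhaustive (Λ.s (I n hn)) E →
      ∃ c ∈ E, ∃ h : toE (n + Λ.d c) ≤ y.deg + toE (Λ.d a), ∃ h',
        I (n + Λ.d c) h = Λ.comp (I n hn) c h' := by
    -- Write `a y(0, N) = x(0, n) e`. By `Exhaustive.ext` the `c` for which `ec` is a minimal common
    -- extension with some `b ∈ E` form a finite exhaustive set at `s(e)`. So `y` follows such a `c`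
    -- from `N`, and then `x` follows the corresponding `b` from `n`.
    intro n hn E hE hEx
    obtain ⟨e, he, heJ⟩ := hI n hn
    set N := n ⊔ Λ.d a - Λ.d a with hN
    have hvert : y.vert N (hle n hn) = Λ.s e := by
      rw [← Λ.s_comp _ e he, heJ, Λ.s_comp, y.s_initial]
    rw [he] at hEx
    obtain ⟨c, ⟨b, hbE, c', h₁, h₂, h₃, -⟩, hc, hseg⟩ := y.boundary N (hle n hn) _
      (hΛ.finite_ext e hE) (hvert ▸ hEx.ext)
    dsimp only at h₁ h₂ h₃
    have hIb : Λ.s (I n hn) = Λ.r b := he.trans (hEx.1 b hbE).symm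
    have hJc : J (N + Λ.d c) hc = Λ.comp (J N (hle n hn)) c (by
        rw [← heJ, Λ.s_comp, h₁]) := by
      have e1 : y.initial (N + Λ.d c) hc = Λ.comp (y.initial N (hle n hn)) c (by
        rw [y.s_initial, hvert, h₁]) :=
        (y.initial_comp_seg le_self_add (hle n hn) hc).trans (comp_congr rfl hseg _ _)
      exact (comp_congr rfl e1 _ (by rw [Λ.r_comp]; exact hs _ _)).trans (Λ.assoc _ _ _ _ _).symm
    have hJb : Λ.IsInitial (Λ.comp (I n hn) b hIb) (J (N + Λ.d c) hc) := by
      refine ⟨c', (Λ.s_comp _ _ _).trans h₂, ?_⟩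
      rw [Λ.assoc _ _ _ hIb h₂, hJc, ← comp_congr rfl h₃ (he.trans (Λ.r_comp _ _ _).symm) _,
        ← Λ.assoc _ _ _ he h₁]
      exact comp_congr heJ rfl _ _
    have hle' : n + Λ.d b ≤ N + Λ.d c + Λ.d a := by
      have := hJb.d_le
      rwa [Λ.d_comp, hdI, hdJ] at this
    refine ⟨b, hbE, (toE_mono hle').trans (hge _ hc), hIb, ?_⟩
    refine IsInitial.eq_of_d_eq (c := J (N + Λ.d c) hc) ?_ hJb (by rw [Λ.d_comp, hdI, hdI])
    rw [← hIJ _ _ (hge _ hc)]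
    exact hII _ _ _ _ hle'
  have hI0 : ∀ h, I (Λ.d a) h = a := by
    intro h
    exact (hI _ h).eq_of_d_eq (isInitial_comp _ _ _) (hdI _ _)
  have hda : toE (Λ.d a) ≤ y.deg + toE (Λ.d a) := le_add_self
  have hx : BoundaryPath.ofInitial _ I hdI hII hb ∈ Λ.cyl a :=
    ⟨hda, (BoundaryPath.ofInitial_initial _ _).trans (hI0 _)⟩
  refine ⟨_, hx, hda, ?_⟩
  have hdeg : ((BoundaryPath.ofInitial _ I hdI hII hb).shift (Λ.d a) hda).deg = y.deg := by
    funext i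
    exact (ENat.addLECancellable_natCast _).add_tsub_cancel_right
  refine BoundaryPath.ext_seg hdeg fun p q hpq hx hy => ?_
  have hp := (toE_mono hpq).trans hy
  have e1 := (BoundaryPath.ofInitial _ I hdI hII hb).initial_comp_seg
    (add_le_add_left hpq (Λ.d a)) (hge p hp) (hge q hy)
  rw [BoundaryPath.ofInitial_initial, hIJ q hy] at e1
  have e2 : J q hy = Λ.comp (J p hp) (y.seg p q hpq hy) (by
      rw [Λ.s_comp, y.s_initial, y.r_seg _ _ _ _ hp]) := by
    refine Eq.trans ?_ (Λ.assoc _ _ _ (hs p hp) (by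
      rw [y.s_initial, y.r_seg _ _ _ _ hp])).symm
    exact comp_congr rfl (y.initial_comp_seg hpq hp hy) _ _
  refine (comp_inj (e1.symm.trans e2) ?_).2
  exact (BoundaryPath.d_initial _ _ _).trans (hdJ _ _).symm

end Paths

/-! ### The topology of the boundary path space. -/

section TopologyLemmas

open Filter Topology

variable {k : ℕ} {Λ : KGraph.{u} k}

theorem cylDiff_eq_empty {a : Λ.Mor} {G : Set Λ.Mor} (hG : G.Finite)
    (hex : Λ.Exhaustive (Λ.s a) G) : Λ.cylDiff a G = ∅ := by
  refine Set.eq_empty_of_forall_notMem ?_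
  rintro x ⟨hx, hxG⟩
  have hv := s_eq_vert hx hx.1
  obtain ⟨c, hc, h, hseg⟩ := x.boundary (Λ.d a) hx.1 G hG (hv ▸ hex)
  have hac : Λ.s a = Λ.r c := (hex.1 c hc).symm
  refine hxG c hc hac ((mem_cyl_comp hac).2 ⟨hx, hx.1, BoundaryPath.le_shift_deg h, ?_⟩)
  rw [x.shift_initial _ _ h, hseg]

/-- The restrictions on `G` in the basis are harmless: elements outside `s(a)Λ` remove nothing, and
an exhaustive `G` leaves the empty set. -/
theorem isOpen_cylDiff (a : Λ.Mor) {G : Set Λ.Mor} (hG : G.Finite) :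
    IsOpen (Λ.cylDiff a G) := by
  have h1 : Λ.cylDiff a G = Λ.cylDiff a {c ∈ G | Λ.r c = Λ.s a} := by
    ext x
    exact and_congr_right fun _ =>
      ⟨fun h c hc => h c hc.1, fun h c hc hac => h c ⟨hc, hac.symm⟩ hac⟩
  have h2 : {c ∈ G | Λ.r c = Λ.s a}.Finite := hG.subset (Set.sep_subset _ _)
  rw [h1]
  by_cases hex : Λ.Exhaustive (Λ.s a) {c ∈ G | Λ.r c = Λ.s a}
  · rw [cylDiff_eq_empty h2 hex]
    exact isOpen_empty
  · exact TopologicalSpace.isOpen_generateFrom_of_mem ⟨a, _, ⟨h2, fun c hc => hc.2, hex⟩, rfl⟩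

theorem isOpen_cyl (a : Λ.Mor) : IsOpen (Λ.cyl a) := by
  have : Λ.cyl a = Λ.cylDiff a ∅ := by
    ext x
    exact ⟨fun h => ⟨h, fun c hc => hc.elim⟩, fun h => h.1⟩
  rw [this]
  exact isOpen_cylDiff a Set.finite_empty

theorem cyl_mem_nhds {x : Λ.BoundaryPath} {a : Λ.Mor} (h : x ∈ Λ.cyl a) : Λ.cyl a ∈ 𝓝 x :=
  (isOpen_cyl a).mem_nhds h

theorem isClosed_cyl (a : Λ.Mor) : IsClosed (Λ.cyl a) := by
  rw [← isOpen_compl_iff, isOpen_iff_mem_nhds]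
  intro x hx
  -- This is `d(x) ⊓ d(a)`, finite even if `d(x)` is not. Either `a = x(0, n)c`, and removing `Z(a)`
  -- from `Z(x(0, n))` leaves a basic neighbourhood of `x`, or `Z(x(0, n))` is already disjoint from
  -- `Z(a)`.
  let n : Fin k → ℕ := fun i => (min (x.deg i) (Λ.d a i : ℕ∞)).toNat
  have hcast : ∀ i, (n i : ℕ∞) = min (x.deg i) (Λ.d a i : ℕ∞) := fun i =>
    ENat.natCast_toNat (ne_top_of_le_ne_top (ENat.natCast_ne_top (Λ.d a i)) (min_le_right _ _))
  have hn : toE n ≤ x.deg := fun i => (hcast i).le.trans (min_le_left _ _)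
  have hna : n ≤ Λ.d a := fun i => by
    have := (hcast i).le.trans (min_le_right _ _)
    exact_mod_cast this
  by_cases hi : Λ.IsInitial (x.initial n hn) a
  · obtain ⟨c, hc, hca⟩ := hi
    refine mem_of_superset ((isOpen_cylDiff (x.initial n hn) (Set.finite_singleton c)).mem_nhds
      ⟨x.mem_cyl_initial n hn, ?_⟩) ?_
    · rintro _ rfl h hxc
      exact hx (hca ▸ hxc)
    · rintro y ⟨-, hy⟩ hya
      exact hy c rfl hc (hca ▸ hya)
  · refine mem_of_superset (cyl_mem_nhds (x.mem_cyl_initial n hn)) fun y hy hya => hi ?_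
    exact isInitial_of_mem_cyl hy hya (by rwa [x.d_initial])

/-- A basic open set is a finite intersection of a cylinder with complements of cylinders. -/
theorem continuous_of_isClopen_preimage_cyl {X : Type*} [TopologicalSpace X]
    {f : X → Λ.BoundaryPath} (hf : ∀ a, IsClopen (f ⁻¹' Λ.cyl a)) : Continuous f := by
  refine continuous_generateFrom_iff.2 ?_
  rintro _ ⟨a, G, hG, rfl⟩
  have : f ⁻¹' Λ.cylDiff a G =
      f ⁻¹' Λ.cyl a ∩ ⋂ c ∈ G, ⋂ h : Λ.s a = Λ.r c, (f ⁻¹' Λ.cyl (Λ.comp a c h))ᶜ := by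
    ext x
    simp [cylDiff]
  rw [this]
  refine (hf a).2.inter (hG.1.isOpen_biInter fun c _ => ?_)
  by_cases h : Λ.s a = Λ.r c
  · simpa [h] using (hf _).compl.2
  · simp [h]

theorem continuous_shift (m : Fin k → ℕ) :
    Continuous fun x : {x : Λ.BoundaryPath // toE m ≤ x.deg} => x.1.shift m x.2 := by
  refine continuous_of_isClopen_preimage_cyl fun b => ⟨?_, ?_⟩
  · rw [← isOpen_compl_iff, isOpen_iff_mem_nhds]
    rintro ⟨x, hx⟩ hxb
    -- On `Z(x(0, m))` the condition `σ^m(y) ∈ Z(b)` reads `y ∈ Z(x(0, m)b)`, and it never holds if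
    -- this product is undefined.
    by_cases h : Λ.s (x.initial m hx) = Λ.r b
    · have hmem : x ∉ Λ.cyl (Λ.comp (x.initial m hx) b h) := by
        intro hc
        obtain ⟨_, hm, hc⟩ := (mem_cyl_comp h).1 hc
        refine hxb ?_
        have e : x.shift m hx = x.shift (Λ.d (x.initial m hx)) hm := by
          congr 1
          exact (x.d_initial m hx).symm
        rw [Set.mem_preimage, e]
        exact hc
      have hU := ((isOpen_cyl (x.initial m hx)).inter (isClosed_cyl _).isOpen_compl).mem_nhds
        ⟨x.mem_cyl_initial m hx, hmem⟩
      filter_upwards [continuousAt_subtype_val.preimage_mem_nhds hU]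
      rintro ⟨y, hy⟩ ⟨hy1, hy2⟩ hyb
      refine hy2 ((mem_cyl_comp h).2 ⟨hy1, hy1.1, ?_⟩)
      have e : y.shift m hy = y.shift (Λ.d (x.initial m hx)) hy1.1 := by
        congr 1
        exact (x.d_initial m hx).symm
      rw [← e]
      exact hyb
    · filter_upwards [continuousAt_subtype_val.preimage_mem_nhds
        (cyl_mem_nhds (x.mem_cyl_initial m hx))]
      rintro ⟨y, hy⟩ hy1 ⟨hb, hyb⟩
      refine h ?_
      rw [s_eq_vert hy1 hy1.1, ← hyb, BoundaryPath.r_initial]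
      exact y.vert_congr ((x.d_initial m hx).trans (zero_add m).symm) _ _
  · rw [isOpen_iff_mem_nhds]
    rintro ⟨x, hx⟩ hxb
    obtain ⟨hb, hxb⟩ := hxb
    have hmb : toE (m + Λ.d b) ≤ x.deg := by
      rw [add_comm]
      exact toE_add_le hx hb
    filter_upwards [continuousAt_subtype_val.preimage_mem_nhds
      (cyl_mem_nhds (x.mem_cyl_initial _ hmb))]
    rintro ⟨y, hy⟩ hy1
    have hyd : toE (m + Λ.d b) ≤ y.deg := by
      have := hy1.1
      rwa [x.d_initial] at this
    refine ⟨BoundaryPath.le_shift_deg hyd, ?_⟩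
    have e : y.initial _ hyd = x.initial _ hmb :=
      eq_of_mem_cyl (y.mem_cyl_initial _ hyd) hy1 ((y.d_initial _ _).trans (x.d_initial _ _).symm)
    rw [y.initial_comp_seg le_self_add hy hyd, x.initial_comp_seg le_self_add hx hmb] at e
    rw [y.shift_initial _ _ hyd, (comp_inj e ((y.d_initial _ _).trans (x.d_initial _ _).symm)).2,
      ← x.shift_initial hx hb hmb, hxb]

end TopologyLemmas

/-! ### Basic bisections and the topology of the groupoid. -/

section GroupoidTopology

open Filter Topology

variable {k : ℕ} {Λ : KGraph.{u} k}

theorem BPGroupoid.exists_shiftEq (g : Λ.BPGroupoid) :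
    ∃ p q, toZ p - toZ q = g.lag ∧ ShiftEq g.rng p g.src q := by
  obtain ⟨p, q, hp, hq, hl, h⟩ := g.mem
  exact ⟨p, q, hl, hp, hq, h⟩

/-- The groupoid element `(x, p - q, y)`, where `σ^p(x) = σ^q(y)`. -/
def ShiftEq.toGroupoid {x y : Λ.BoundaryPath} {p q : Fin k → ℕ} (h : ShiftEq x p y q) :
    Λ.BPGroupoid where
  rng := x
  lag := toZ p - toZ q
  src := y
  mem := ⟨p, q, h.1, h.2.1, rfl, h.2.2⟩

theorem mem_bisec {g : Λ.BPGroupoid} {a b : Λ.Mor} :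
    g ∈ Λ.bisec a b ↔ g.lag = toZ (Λ.d a) - toZ (Λ.d b) ∧ g.rng ∈ Λ.cyl a ∧ g.src ∈ Λ.cyl b ∧
      ShiftEq g.rng (Λ.d a) g.src (Λ.d b) :=
  Iff.rfl

theorem mem_bisec_initial {g : Λ.BPGroupoid} {p q : Fin k → ℕ} (h : ShiftEq g.rng p g.src q)
    (hl : toZ p - toZ q = g.lag) :
    g ∈ Λ.bisec (g.rng.initial p h.1) (g.src.initial q h.2.1) := by
  rw [mem_bisec, BoundaryPath.d_initial, BoundaryPath.d_initial]
  exact ⟨hl.symm, BoundaryPath.mem_cyl_initial _ _ _, BoundaryPath.mem_cyl_initial _ _ _, h⟩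

theorem exists_mem_bisec (g : Λ.BPGroupoid) : ∃ a b, g ∈ Λ.bisec a b :=
  let ⟨_, _, hl, h⟩ := g.exists_shiftEq
  ⟨_, _, mem_bisec_initial h hl⟩

theorem s_eq_of_mem_bisec {g : Λ.BPGroupoid} {a b : Λ.Mor} (h : g ∈ Λ.bisec a b) :
    Λ.s a = Λ.s b := by
  obtain ⟨-, ha, hb, hp, hq, e⟩ := h
  have h1 : (g.rng.shift _ hp).vert 0 (toE_zero_le _) =
      (g.src.shift _ hq).vert 0 (toE_zero_le _) := by
    rw [← BoundaryPath.r_initial _ 0 (toE_zero_le _), ← BoundaryPath.r_initial _ 0 (toE_zero_le _)]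
    exact congrArg Λ.r (BoundaryPath.seg_of_eq e _ _ _)
  rw [s_eq_vert ha hp, s_eq_vert hb hq]
  exact (g.rng.vert_congr (zero_add _).symm _ _).trans
    (h1.trans (g.src.vert_congr (zero_add _) _ _))

/-- In a bisection the source is determined by the range, so smaller bisections are detected on
ranges alone. -/
theorem mem_bisec_comp {g : Λ.BPGroupoid} {a b c : Λ.Mor} (h : g ∈ Λ.bisec a b)
    (hac : Λ.s a = Λ.r c) (hbc : Λ.s b = Λ.r c) :
    g ∈ Λ.bisec (Λ.comp a c hac) (Λ.comp b c hbc) ↔ g.rng ∈ Λ.cyl (Λ.comp a c hac) := by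
  refine ⟨fun h => h.2.1, fun hr => ?_⟩
  obtain ⟨hl, ha, hb, hs⟩ := mem_bisec.1 h
  refine mem_bisec.2 ⟨?_, hr, mem_cyl_comp_of_shiftEq hs hb hr, ?_⟩
  · rw [hl, Λ.d_comp, Λ.d_comp]
    funext i
    simp [toZ]
  · rw [Λ.d_comp, Λ.d_comp]
    refine hs.add ?_
    rw [← Λ.d_comp _ _ hac]
    exact hr.1

/-- The tails of range and source after `a` and `b` both begin with `c` and agree beyond it, so they
are equal by `eq_of_shiftEq`. -/
theorem mem_bisec_of_comp {g : Λ.BPGroupoid} {a b c : Λ.Mor} {hac : Λ.s a = Λ.r c}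
    {hbc : Λ.s b = Λ.r c} (h : g ∈ Λ.bisec (Λ.comp a c hac) (Λ.comp b c hbc)) :
    g ∈ Λ.bisec a b := by
  obtain ⟨hl, ha, hb, hs⟩ := mem_bisec.1 h
  obtain ⟨ha₁, ha₂, ha₃⟩ := (mem_cyl_comp hac).1 ha
  obtain ⟨hb₁, hb₂, hb₃⟩ := (mem_cyl_comp hbc).1 hb
  refine mem_bisec.2 ⟨?_, ha₁, hb₁, ha₂, hb₂, eq_of_shiftEq ha₃ hb₃ ?_⟩
  · rw [hl, Λ.d_comp, Λ.d_comp]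
    funext i
    simp [toZ]
  · rw [Λ.d_comp, Λ.d_comp] at hs
    exact (shiftEq_shift hs.1 ha₂).symm.trans_same (hs.trans_same (shiftEq_shift hs.2.1 hb₂))

theorem eq_of_mem_bisec {g g' : Λ.BPGroupoid} {a b : Λ.Mor} (h : g ∈ Λ.bisec a b)
    (h' : g' ∈ Λ.bisec a b) (hr : g.rng = g'.rng) : g = g' := by
  obtain ⟨hl, ha, hb, hs⟩ := mem_bisec.1 h
  obtain ⟨hl', ha', hb', hs'⟩ := mem_bisec.1 h'
  refine BPGroupoid.ext hr (hl.trans hl'.symm) (eq_of_shiftEq hb hb' ?_)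
  rw [hr] at hs
  exact hs.symm.trans_same hs'

theorem isOpen_bisecDiff (a b : Λ.Mor) {G : Set Λ.Mor} (hG : G.Finite) :
    IsOpen (Λ.bisecDiff a b G) := by
  by_cases hab : Λ.s a = Λ.s b
  · have h1 : Λ.bisecDiff a b G = Λ.bisecDiff a b {c ∈ G | Λ.r c = Λ.s a} := by
      ext x
      exact and_congr_right fun _ =>
        ⟨fun h c hc => h c hc.1, fun h c hc hac => h c ⟨hc, hac.symm⟩ hac⟩
    have h2 : {c ∈ G | Λ.r c = Λ.s a}.Finite := hG.subset (Set.sep_subset _ _)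
    rw [h1]
    by_cases hex : Λ.Exhaustive (Λ.s a) {c ∈ G | Λ.r c = Λ.s a}
    · convert isOpen_empty
      refine Set.eq_empty_of_forall_notMem ?_
      rintro g ⟨hg, hgG⟩
      refine Set.eq_empty_iff_forall_notMem.1 (cylDiff_eq_empty h2 hex) g.rng ⟨hg.2.1, ?_⟩
      exact fun c hc hac hr => hgG c hc hac (hab.symm.trans hac) ((mem_bisec_comp hg _ _).2 hr)
    · exact TopologicalSpace.isOpen_generateFrom_of_mem
        ⟨a, b, _, hab, ⟨h2, fun c hc => hc.2, hex⟩, rfl⟩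
  · convert isOpen_empty
    exact Set.eq_empty_of_forall_notMem fun g hg => hab (s_eq_of_mem_bisec hg.1)

theorem isOpen_bisec (a b : Λ.Mor) : IsOpen (Λ.bisec a b) := by
  have : Λ.bisec a b = Λ.bisecDiff a b ∅ := by
    ext x
    exact ⟨fun h => ⟨h, fun c hc => hc.elim⟩, fun h => h.1⟩
  rw [this]
  exact isOpen_bisecDiff a b Set.finite_empty

theorem bisec_mem_nhds {g : Λ.BPGroupoid} {a b : Λ.Mor} (h : g ∈ Λ.bisec a b) :
    Λ.bisec a b ∈ 𝓝 g :=
  (isOpen_bisec a b).mem_nhds h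

/-- In `(x, p - q, y)` the degree `p` can be taken above any given degree of an initial segment
of `x`. -/
theorem BPGroupoid.exists_ge (g : Λ.BPGroupoid) {n : Fin k → ℕ} (hn : toE n ≤ g.rng.deg) :
    ∃ p q, n ≤ p ∧ toZ p - toZ q = g.lag ∧ ShiftEq g.rng p g.src q := by
  obtain ⟨p, q, hl, h⟩ := g.exists_shiftEq
  refine ⟨p ⊔ n, q + (p ⊔ n - p), le_sup_right, ?_,
    h.add_left_le le_sup_left (toE_sup_le h.1 hn)⟩
  rw [← hl]
  funext i
  simp only [toZ, Pi.sub_apply, Pi.add_apply, Pi.sup_apply]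
  omega

theorem FinitelyAligned.continuous_rng (hΛ : Λ.FinitelyAligned) :
    Continuous (BPGroupoid.rng : Λ.BPGroupoid → Λ.BoundaryPath) := by
  refine continuous_of_isClopen_preimage_cyl fun c => ⟨?_, ?_⟩
  · rw [← isOpen_compl_iff, isOpen_iff_mem_nhds]
    intro g hg
    obtain ⟨a, b, hab⟩ := exists_mem_bisec g
    have hs := s_eq_of_mem_bisec hab
    -- An element of `Z(a *_s b)` with range in `Z(c)` has its range in the cylinder of a minimal
    -- common extension of `a` and `c`. Finite alignment leaves only finitely many of these to
    -- remove.
    refine mem_of_superset ((isOpen_bisecDiff a b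
      (hΛ.finite_ext a (Set.finite_singleton c))).mem_nhds ⟨hab, ?_⟩) ?_
    · rintro e ⟨_, rfl, e', h₁, h₂, h₃, -⟩ ha hb hge
      refine hg (cyl_of_isInitial (isInitial_comp _ _ h₂) (?_ : g.rng ∈ _))
      rw [← h₃]
      exact hge.2.1
    · rintro k' ⟨hk, hk'⟩ (hkc : k'.rng ∈ Λ.cyl c)
      have hj := toE_sup_le hk.2.1.1 hkc.1
      obtain ⟨⟨e, e'⟩, he, h, hi⟩ := exists_mem_minExt
        ((mem_cyl_iff_isInitial hj le_sup_left).1 hk.2.1)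
        ((mem_cyl_iff_isInitial hj le_sup_right).1 hkc)
      refine hk' e ⟨c, rfl, e', he⟩ h (hs.symm.trans h) ((mem_bisec_comp hk _ _).2 ?_)
      exact cyl_of_isInitial hi (BoundaryPath.mem_cyl_initial _ _ _)
  · rw [isOpen_iff_mem_nhds]
    intro g hg
    obtain ⟨p, q, hp, hl, h⟩ := g.exists_ge hg.1
    refine mem_of_superset (bisec_mem_nhds (mem_bisec_initial h hl)) fun k' hk => ?_
    exact cyl_of_isInitial ((mem_cyl_iff_isInitial h.1 hp).1 hg) hk.2.1

/-- The bisection `Z(a *_s b)` is homeomorphic to its range. -/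
theorem FinitelyAligned.nhds_eq (hΛ : Λ.FinitelyAligned) {g : Λ.BPGroupoid} {a b : Λ.Mor}
    (h : g ∈ Λ.bisec a b) : 𝓝 g = comap BPGroupoid.rng (𝓝 g.rng) ⊓ 𝓟 (Λ.bisec a b) := by
  refine le_antisymm (le_inf (hΛ.continuous_rng.tendsto g).le_comap
    (le_principal_iff.2 (bisec_mem_nhds h))) ?_
  refine le_of_le_of_eq (le_iInf₂ fun U hU => ?_)
    (TopologicalSpace.nhds_generateFrom (a := g)).symm
  obtain ⟨hg, a', b', G, hs', hG, rfl⟩ := hU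
  rw [le_principal_iff, mem_inf_principal, mem_comap]
  obtain ⟨hl, ha, hb, hs⟩ := mem_bisec.1 h
  obtain ⟨hl', ha', hb', -⟩ := mem_bisec.1 hg.1
  -- A segment of `g.rng` extends both `a` and `a'`, giving `ae = a'e'`; since the lags agree, also
  -- `be = b'e'`. Hence an element of `Z(a *_s b)` with range in `Z(ae)` lies in `Z(a' *_s b')`.
  have hj := toE_sup_le ha.1 ha'.1
  have hxj := g.rng.mem_cyl_initial _ hj
  have hdj := g.rng.d_initial _ hj
  obtain ⟨e, he, hi⟩ := (mem_cyl_iff_isInitial hj le_sup_left).1 ha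
  obtain ⟨e', he', hi'⟩ := (mem_cyl_iff_isInitial hj le_sup_right).1 ha'
  have hbe : Λ.s b = Λ.r e := (s_eq_of_mem_bisec h).symm.trans he
  have hbe' : Λ.s b' = Λ.r e' := hs'.symm.trans he'
  have hae : Λ.comp a e he = Λ.comp a' e' he' := hi.trans hi'.symm
  clear hi'
  rw [← hi] at hxj
  have hxj' := hae ▸ hxj
  have hbb : Λ.comp b e hbe = Λ.comp b' e' hbe' := by
    refine eq_of_mem_cyl ((mem_bisec_comp h he hbe).2 hxj).2.2.1
      ((mem_bisec_comp hg.1 he' hbe').2 hxj').2.2.1 ?_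
    have h1 := congrArg Λ.d hae
    rw [Λ.d_comp, Λ.d_comp] at h1 ⊢
    funext i
    have h2 := congrFun h1 i
    have h3 := congrFun (hl.symm.trans hl') i
    simp only [toZ, Pi.sub_apply, Pi.add_apply] at h2 h3 ⊢
    omega
  refine ⟨Λ.cyl (Λ.comp a e he) ∩ Λ.cylDiff a' G, inter_mem (cyl_mem_nhds hxj)
    ((isOpen_cylDiff a' hG.1).mem_nhds ⟨ha', fun c hc hac hr => ?_⟩), ?_⟩
  · exact hg.2 c hc hac (hs'.symm.trans hac) ((mem_bisec_comp hg.1 _ _).2 hr)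
  · rintro k' ⟨hk₁, hk₂⟩ hk
    refine ⟨mem_bisec_of_comp (c := e') (hac := he') (hbc := hbe') ?_, fun c hc hac hbc hkc =>
      hk₂.2 c hc hac hkc.2.1⟩
    rw [← hae, ← hbb]
    exact (mem_bisec_comp hk _ _).2 hk₁

/-- Each `y ∈ Z(a)` is the range of an element of `Z(a *_s b)`, because `exists_concat` provides the
boundary path `b σ^{d(a)}(y)`. -/
theorem FinitelyAligned.isOpenMap_rng (hΛ : Λ.FinitelyAligned) :
    IsOpenMap (BPGroupoid.rng : Λ.BPGroupoid → Λ.BoundaryPath) := by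
  refine IsOpenMap.of_nhds_le fun g => ?_
  obtain ⟨a, b, hab⟩ := exists_mem_bisec g
  intro W hW
  rw [mem_map, hΛ.nhds_eq hab, mem_inf_principal, mem_comap] at hW
  obtain ⟨V, hV, hVW⟩ := hW
  filter_upwards [hV, cyl_mem_nhds hab.2.1] with y hy hya
  obtain ⟨z, hz, hzb, hzy⟩ := hΛ.exists_concat b (y.shift _ hya.1) (by
    rw [← s_eq_of_mem_bisec hab, s_eq_vert hya hya.1]
    exact y.vert_congr (zero_add _).symm _ _)
  have hs : ShiftEq y (Λ.d a) z (Λ.d b) := ⟨hya.1, hzb, hzy.symm⟩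
  exact hVW (a := hs.toGroupoid) hy ⟨rfl, hya, hz, hs⟩

theorem BPGroupoid.inv_mem_bisec {g : Λ.BPGroupoid} {a b : Λ.Mor} :
    g.inv ∈ Λ.bisec a b ↔ g ∈ Λ.bisec b a := by
  rw [mem_bisec, mem_bisec]
  constructor
  · rintro ⟨h1, h2, h3, h4⟩
    exact ⟨by rw [← neg_sub, ← h1]; exact (neg_neg _).symm, h3, h2, h4.symm⟩
  · rintro ⟨h1, h2, h3, h4⟩
    exact ⟨by rw [← neg_sub, ← h1]; rfl, h3, h2, h4.symm⟩

theorem BPGroupoid.continuous_inv :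
    Continuous (BPGroupoid.inv : Λ.BPGroupoid → Λ.BPGroupoid) := by
  refine continuous_generateFrom_iff.2 ?_
  rintro _ ⟨a, b, G, -, hG, rfl⟩
  have : BPGroupoid.inv ⁻¹' Λ.bisecDiff a b G = Λ.bisecDiff b a G := by
    ext g
    exact and_congr inv_mem_bisec ⟨fun h c hc ha hb hg => h c hc hb ha (inv_mem_bisec.2 hg),
      fun h c hc ha hb hg => h c hc hb ha (inv_mem_bisec.1 hg)⟩
  rw [this]
  exact isOpen_bisecDiff b a hG.1

theorem FinitelyAligned.continuous_src (hΛ : Λ.FinitelyAligned) :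
    Continuous (BPGroupoid.src : Λ.BPGroupoid → Λ.BoundaryPath) :=
  hΛ.continuous_rng.comp BPGroupoid.continuous_inv

theorem FinitelyAligned.isClosed_bisec (hΛ : Λ.FinitelyAligned) (a b : Λ.Mor) :
    IsClosed (Λ.bisec a b) := by
  rw [← isOpen_compl_iff, isOpen_iff_mem_nhds]
  intro g hg
  by_cases hl : g.lag = toZ (Λ.d a) - toZ (Λ.d b)
  · by_cases ha : g.rng ∈ Λ.cyl a
    · by_cases hb : g.src ∈ Λ.cyl b
      -- Only the tails of the range `x` and the source `y` of `g` can still differ. As `p ≥ d(a)`,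
      -- `x(0, p) = ae` for some `e`. An element common to `Z(x(0, p) *_s y(0, q))` and `Z(a *_s b)`
      -- would force `y(0, q) = be`, and then `g ∈ Z(a *_s b)`.
      · obtain ⟨p, q, hp, hl', h⟩ := g.exists_ge ha.1
        have hbs := mem_bisec_initial h hl'
        refine mem_of_superset (bisec_mem_nhds hbs) fun k' hk hk' => ?_
        obtain ⟨e, he, hi⟩ := (mem_cyl_iff_isInitial h.1 hp).1 ha
        have hbe : Λ.s b = Λ.r e := (s_eq_of_mem_bisec hk').symm.trans he
        have hkb : k'.src ∈ Λ.cyl (Λ.comp b e hbe) :=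
          mem_cyl_comp_of_shiftEq (mem_bisec.1 hk').2.2.2 hk'.2.2.1 (hi ▸ hk.2.1)
        have hbq : Λ.comp b e hbe = g.src.initial q h.2.1 := by
          refine eq_of_mem_cyl hkb hk.2.2.1 ?_
          have h1 := congrArg Λ.d hi
          rw [Λ.d_comp, g.rng.d_initial] at h1
          rw [Λ.d_comp, g.src.d_initial]
          funext i
          have h2 := congrFun h1 i
          have h3 := congrFun (hl'.trans hl) i
          simp only [toZ, Pi.sub_apply, Pi.add_apply] at h2 h3 ⊢
          omega
        refine hg (mem_bisec_of_comp (c := e) (hac := he) (hbc := hbe) ?_)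
        rw [hi, hbq]
        exact hbs
      · filter_upwards [hΛ.continuous_src.continuousAt.preimage_mem_nhds
          ((isClosed_cyl b).isOpen_compl.mem_nhds hb)] with k' hk hk'
        exact hk hk'.2.2.1
    · filter_upwards [hΛ.continuous_rng.continuousAt.preimage_mem_nhds
        ((isClosed_cyl a).isOpen_compl.mem_nhds ha)] with k' hk hk'
      exact hk hk'.2.1
  · obtain ⟨a', b', h⟩ := exists_mem_bisec g
    exact mem_of_superset (bisec_mem_nhds h) fun k' hk hk' =>
      hl (h.1.trans (hk.1.symm.trans hk'.1))

end GroupoidTopology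

open Filter Topology

/-! ### Periods and orbits in terms of the groupoid. -/

section Isotropy

variable {k : ℕ} {Λ : KGraph.{u} k}

theorem innerPeriodPair_iff {x : Λ.BoundaryPath} {m n : Fin k → ℕ} :
    InnerPeriodPair x m n ↔ ∀ᶠ y in 𝓝 x, PeriodPair y m n := by
  rw [eventually_nhds_iff]
  exact ⟨fun ⟨U, h1, h2, h3⟩ => ⟨U, h3, h1, h2⟩, fun ⟨U, h1, h2, h3⟩ => ⟨U, h2, h3, h1⟩⟩

theorem InnerPeriodPair.periodPair {x : Λ.BoundaryPath} {m n : Fin k → ℕ}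
    (h : InnerPeriodPair x m n) : PeriodPair x m n :=
  let ⟨_, _, h2, h3⟩ := h
  h3 x h2

theorem mem_per_iff {x : Λ.BoundaryPath} {l : Fin k → ℤ} :
    l ∈ Per x ↔ ∃ g : Λ.BPGroupoid, g.rng = x ∧ g.src = x ∧ g.lag = l := by
  constructor
  · rintro ⟨m, n, h, rfl⟩
    exact ⟨ShiftEq.toGroupoid h, rfl, rfl, rfl⟩
  · rintro ⟨g, hr, hs, rfl⟩
    obtain ⟨p, q, hl, h⟩ := g.exists_shiftEq
    rw [hr, hs] at h
    exact ⟨p, q, h, hl.symm⟩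

/-- `Per(x)` as a subgroup of `ℤ ^ k`. -/
def perSubgroup (x : Λ.BoundaryPath) : AddSubgroup (Fin k → ℤ) where
  carrier := Per x
  zero_mem' := mem_per_iff.2 ⟨BPGroupoid.unit x, rfl, rfl, rfl⟩
  add_mem' := by
    intro l l' h h'
    obtain ⟨g, hr, hs, hl⟩ := mem_per_iff.1 h
    obtain ⟨g', hr', hs', hl'⟩ := mem_per_iff.1 h'
    exact mem_per_iff.2 ⟨g.mul g' (hs.trans hr'.symm), hr, hs', by rw [← hl, ← hl']; rfl⟩
  neg_mem' := by
    intro l h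
    obtain ⟨g, hr, hs, hl⟩ := mem_per_iff.1 h
    exact mem_per_iff.2 ⟨g.inv, hs, hr, by rw [← hl]; rfl⟩

theorem mem_orb_iff {x y : Λ.BoundaryPath} :
    y ∈ orb x ↔ ∃ g : Λ.BPGroupoid, g.rng = y ∧ g.src = x := by
  constructor
  · rintro ⟨n, m, hn, hm, h⟩
    exact ⟨ShiftEq.toGroupoid ⟨hn, hm, h⟩, rfl, rfl⟩
  · rintro ⟨⟨_, _, _, m, n, hm, hn, hl, h⟩, rfl, rfl⟩
    exact ⟨m, n, hm, hn, h⟩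

end Isotropy

/-! ### The continuous homomorphism defined by half a family of cocycles. -/

namespace CocycleHalf

variable {k₁ k₂ : ℕ} {Λ₁ : KGraph.{u} k₁} {Λ₂ : KGraph.{v} k₂}
  {h : Λ₁.BoundaryPath → Λ₂.BoundaryPath} (F : CocycleHalf h)

open Classical in
/-- The difference `g_m(x) - f_m(x)`, with value `0` where it is not defined. -/
noncomputable def lagAt (m : Fin k₁ → ℕ) (x : Λ₁.BoundaryPath) : Fin k₂ → ℤ :=
  if hm : toE m ≤ x.deg then toZ (F.g m ⟨x, hm⟩) - toZ (F.f m ⟨x, hm⟩) else 0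

theorem lagAt_of_le {m : Fin k₁ → ℕ} {x : Λ₁.BoundaryPath} (hm : toE m ≤ x.deg) :
    F.lagAt m x = toZ (F.g m ⟨x, hm⟩) - toZ (F.f m ⟨x, hm⟩) :=
  dif_pos hm

theorem lagAt_add {m n : Fin k₁ → ℕ} {x : Λ₁.BoundaryPath} (hm : toE m ≤ x.deg)
    (h : toE (m + n) ≤ x.deg) :
    F.lagAt (m + n) x = F.lagAt m x + F.lagAt n (x.shift m hm) := by
  rw [F.lagAt_of_le h, F.lagAt_of_le hm, F.lagAt_of_le (BoundaryPath.le_shift_deg h),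
    F.cocycle m n x h, add_sub_assoc]

theorem lagAt_sub_add {x y : Λ₁.BoundaryPath} {p q a : Fin k₁ → ℕ} (hs : ShiftEq x p y q)
    (ha : toE (p + a) ≤ x.deg) :
    F.lagAt (p + a) x - F.lagAt (q + a) y = F.lagAt p x - F.lagAt q y := by
  rw [F.lagAt_add hs.1 ha, F.lagAt_add hs.2.1 (hs.add ha).2.1, hs.2.2]
  abel

/-- Two representations of one groupoid element are compared at `p ⊔ p'`; enlarging the degrees does
not change the difference. This makes `map` well defined. -/
theorem lagAt_sub_eq {x y : Λ₁.BoundaryPath} {p q p' q' : Fin k₁ → ℕ} (hs : ShiftEq x p y q)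
    (hs' : ShiftEq x p' y q') (hl : toZ p - toZ q = toZ p' - toZ q') :
    F.lagAt p x - F.lagAt q y = F.lagAt p' x - F.lagAt q' y := by
  have e₁ : p + (p ⊔ p' - p) = p ⊔ p' := add_tsub_cancel_of_le le_sup_left
  have e₂ : p' + (p ⊔ p' - p') = p ⊔ p' := add_tsub_cancel_of_le le_sup_right
  have e₃ : q + (p ⊔ p' - p) = q' + (p ⊔ p' - p') := by
    funext i
    have := congrFun hl i
    simp only [toZ, Pi.sub_apply, Pi.add_apply, Pi.sup_apply] at this ⊢
    omega
  have hj := toE_sup_le hs.1 hs'.1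
  rw [← F.lagAt_sub_add (a := p ⊔ p' - p) hs (by rwa [e₁]),
    ← F.lagAt_sub_add (a := p ⊔ p' - p') hs' (by rwa [e₂]), e₁, e₂, e₃]

theorem shiftEq_cocycle {m : Fin k₁ → ℕ} {x : Λ₁.BoundaryPath} (hm : toE m ≤ x.deg) :
    ShiftEq (h x) (F.g m ⟨x, hm⟩) (h (x.shift m hm)) (F.f m ⟨x, hm⟩) :=
  ⟨F.g_le m ⟨x, hm⟩, F.f_le m ⟨x, hm⟩, (F.shift_eq m ⟨x, hm⟩).symm⟩

/-- The relations for `x` and `y` are joined along `h(σ^p(x)) = h(σ^q(y))`. The cocycle values are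
variables so that near a fixed point its own, locally constant, values can be inserted. -/
theorem shiftEq_map {x y : Λ₁.BoundaryPath} {p q : Fin k₁ → ℕ} (hs : ShiftEq x p y q)
    {gx fx gy fy : Fin k₂ → ℕ} (hgx : F.g p ⟨x, hs.1⟩ = gx) (hfx : F.f p ⟨x, hs.1⟩ = fx)
    (hgy : F.g q ⟨y, hs.2.1⟩ = gy) (hfy : F.f q ⟨y, hs.2.1⟩ = fy) :
    ShiftEq (h x) (gx + (fx ⊔ fy - fx)) (h y) (gy + (fx ⊔ fy - fy)) ∧
      toZ (gx + (fx ⊔ fy - fx)) - toZ (gy + (fx ⊔ fy - fy)) =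
        F.lagAt p x - F.lagAt q y := by
  have h1 := F.shiftEq_cocycle hs.1
  have h2 := F.shiftEq_cocycle hs.2.1
  rw [F.lagAt_of_le hs.1, F.lagAt_of_le hs.2.1]
  rw [hgx, hfx] at h1 ⊢
  rw [hgy, hfy, ← hs.2.2] at h2
  rw [hgy, hfy]
  refine ⟨h1.trans h2.symm, ?_⟩
  funext i
  simp only [toZ, Pi.sub_apply, Pi.add_apply, Pi.sup_apply]
  omega

/-- The homomorphism of boundary path groupoids defined by a family of cocycles:
`(x, m - n, y)` with `σ^m(x) = σ^n(y)` is mapped to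
`(h(x), g_m(x) - f_m(x) - g_n(y) + f_n(y), h(y))`. -/
noncomputable def map (g : Λ₁.BPGroupoid) : Λ₂.BPGroupoid where
  rng := h g.rng
  lag := F.lagAt g.exists_shiftEq.choose g.rng - F.lagAt g.exists_shiftEq.choose_spec.choose g.src
  src := h g.src
  mem := by
    obtain ⟨h1, h2⟩ := F.shiftEq_map g.exists_shiftEq.choose_spec.choose_spec.2 rfl rfl rfl rfl
    exact ⟨_, _, h1.1, h1.2.1, h2, h1.2.2⟩

theorem map_lag {g : Λ₁.BPGroupoid} {p q : Fin k₁ → ℕ} (hs : ShiftEq g.rng p g.src q)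
    (hl : toZ p - toZ q = g.lag) :
    (F.map g).lag = F.lagAt p g.rng - F.lagAt q g.src :=
  F.lagAt_sub_eq g.exists_shiftEq.choose_spec.choose_spec.2 hs
    (g.exists_shiftEq.choose_spec.choose_spec.1.trans hl.symm)

theorem map_unit_lag (x : Λ₁.BoundaryPath) : (F.map (BPGroupoid.unit x)).lag = 0 := by
  have hs : ShiftEq x 0 x 0 := ⟨toE_zero_le _, toE_zero_le _, rfl⟩
  rw [F.map_lag (g := BPGroupoid.unit x) hs (sub_self _)]
  exact sub_self _

theorem map_unit (x : Λ₁.BoundaryPath) :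
    F.map (BPGroupoid.unit x) = BPGroupoid.unit (h x) :=
  BPGroupoid.ext rfl (F.map_unit_lag x) rfl

theorem map_inv_lag (g : Λ₁.BPGroupoid) : (F.map g.inv).lag = -(F.map g).lag := by
  obtain ⟨p, q, hl, hs⟩ := g.exists_shiftEq
  rw [F.map_lag hs hl, F.map_lag (g := g.inv) hs.symm (by rw [← neg_sub, hl]; rfl), neg_sub]
  rfl

/-- Both factors are rewritten with degree `q ⊔ p'` at the middle path, whose two contributions
cancel. -/
theorem map_mul_lag (g g' : Λ₁.BPGroupoid) (hc : g.src = g'.rng) :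
    (F.map (g.mul g' hc)).lag = (F.map g).lag + (F.map g').lag := by
  obtain ⟨p, q, hl, hs⟩ := g.exists_shiftEq
  obtain ⟨p', q', hl', hs'⟩ := g'.exists_shiftEq
  have e₁ : q + (q ⊔ p' - q) = q ⊔ p' := add_tsub_cancel_of_le le_sup_left
  have e₂ : p' + (q ⊔ p' - p') = q ⊔ p' := add_tsub_cancel_of_le le_sup_right
  have hj : toE (q ⊔ p') ≤ g.src.deg := toE_sup_le hs.2.1 (hc ▸ hs'.1)
  have h1 := hs.symm.add (a := q ⊔ p' - q) (by rwa [e₁])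
  have h2 := hs'.add (a := q ⊔ p' - p') (by rw [e₂]; exact hc ▸ hj)
  rw [e₁] at h1
  rw [e₂, ← hc] at h2
  have h3 := h1.symm.trans_same h2
  have k1 : toZ (p + (q ⊔ p' - q)) - toZ (q ⊔ p') = g.lag := by
    rw [← hl]
    funext i
    simp only [toZ, Pi.sub_apply, Pi.add_apply, Pi.sup_apply]
    omega
  have k2 : toZ (q ⊔ p') - toZ (q' + (q ⊔ p' - p')) = g'.lag := by
    rw [← hl']
    funext i
    simp only [toZ, Pi.sub_apply, Pi.add_apply, Pi.sup_apply]
    omega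
  have k3 : toZ (p + (q ⊔ p' - q)) - toZ (q' + (q ⊔ p' - p')) = (g.mul g' hc).lag := by
    refine Eq.trans ?_ (congrArg₂ (· + ·) k1 k2)
    abel
  rw [F.map_lag (g := g.mul g' hc) h3 k3, F.map_lag h1.symm k1,
    F.map_lag (g := g') (hc ▸ h2) k2, ← hc]
  change F.lagAt _ g.rng - F.lagAt _ g'.src = _
  abel

theorem map_mul (g g' : Λ₁.BPGroupoid) (hc : g.src = g'.rng) :
    F.map (g.mul g' hc) = (F.map g).mul (F.map g') (congrArg h hc) :=
  BPGroupoid.ext rfl (F.map_mul_lag g g' hc) rfl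

theorem cocycle_map {Γ : Type w} [Group Γ] {η₁ : Λ₁.GroupFunctor Γ} {η₂ : Λ₂.GroupFunctor Γ}
    (hF : F.Graded η₁ η₂) (g : Λ₁.BPGroupoid) : η₂.cocycle (F.map g) = η₁.cocycle g := by
  obtain ⟨p, q, hl, hs⟩ := g.exists_shiftEq
  obtain ⟨h1, h2⟩ := F.shiftEq_map hs rfl rfl rfl rfl
  rw [η₁.cocycle_eq g hs.1 hs.2.1 hl hs.2.2,
    η₂.cocycle_eq (F.map g) h1.1 h1.2.1 (h2.trans (F.map_lag hs hl).symm) h1.2.2,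
    hF p g.rng hs.1, hF q g.src hs.2.1]
  set fx := F.f p ⟨g.rng, hs.1⟩
  set fy := F.f q ⟨g.src, hs.2.1⟩
  have c1 := F.shiftEq_cocycle hs.1
  have c2 := F.shiftEq_cocycle hs.2.1
  have e : h (g.src.shift q hs.2.1) = h (g.rng.shift p hs.1) := congrArg h hs.2.2.symm
  have e₁ : fx ⊔ fy = fx + (fx ⊔ fy - fx) := (add_tsub_cancel_of_le le_sup_left).symm
  have e₂ : fx ⊔ fy = fy + (fx ⊔ fy - fy) := (add_tsub_cancel_of_le le_sup_right).symm
  have hj : toE (fx ⊔ fy) ≤ (h (g.rng.shift p hs.1)).deg := toE_sup_le c1.2.1 (e ▸ c2.2.1)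
  have hj' : toE (fx ⊔ fy) ≤ (h (g.src.shift q hs.2.1)).deg := e ▸ hj
  -- Both expressions are pushed to degree `fx ⊔ fy` on the common path `h(σ^p(x)) = h(σ^q(y))`,
  -- whose value under `η₂` then cancels.
  rw [η₂.initial_add rfl e₁ c1.1 c1.2.1 c1.2.2 h1.1 hj,
    η₂.initial_add rfl e₂ c2.1 c2.2.1 c2.2.2 h1.2.1 hj']
  have e₃ : (h (g.src.shift q hs.2.1)).initial _ hj' = (h (g.rng.shift p hs.1)).initial _ hj :=
    BoundaryPath.seg_of_eq e _ _ _
  rw [e₃]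
  simp only [mul_inv_rev, inv_inv, mul_assoc, inv_mul_cancel_left]
  rfl

/-- A continuous map to a discrete space is locally constant on its domain. -/
theorem eventually_eq_of_continuous {X : Type*} [TopologicalSpace X] [DiscreteTopology X]
    {P : Λ₁.BoundaryPath → Prop} {f : {x // P x} → X} (hf : Continuous f) {x : Λ₁.BoundaryPath}
    (hx : P x) : ∀ᶠ y in 𝓝 x, ∀ hy, f ⟨y, hy⟩ = f ⟨x, hx⟩ := by
  have h1 : ∀ᶠ y in 𝓝 (⟨x, hx⟩ : {x // P x}), f y = f ⟨x, hx⟩ :=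
    hf.continuousAt.eventually (IsOpen.mem_nhds (isOpen_discrete {f ⟨x, hx⟩}) rfl)
  rw [nhds_subtype_eq_comap, eventually_comap] at h1
  filter_upwards [h1] with y hy hy'
  exact hy ⟨y, hy'⟩ rfl

/-- Near `g` the same `p`, `q` serve and the cocycles are constant, so the images share one pair of
degrees. -/
theorem eventually_map_mem_bisec (hΛ₁ : Λ₁.FinitelyAligned) (hh : Continuous h)
    (g : Λ₁.BPGroupoid) :
    ∃ a b, F.map g ∈ Λ₂.bisec a b ∧ ∀ᶠ g' in 𝓝 g, F.map g' ∈ Λ₂.bisec a b := by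
  obtain ⟨p, q, hl, hs⟩ := g.exists_shiftEq
  obtain ⟨h1, h2⟩ := F.shiftEq_map hs rfl rfl rfl rfl
  have h3 := h2.trans (F.map_lag hs hl).symm
  have hmem : F.map g ∈ Λ₂.bisec ((h g.rng).initial _ h1.1) ((h g.src).initial _ h1.2.1) :=
    mem_bisec_initial (g := F.map g) h1 h3
  refine ⟨_, _, hmem, ?_⟩
  have hr := hΛ₁.continuous_rng.tendsto g
  have hc := hΛ₁.continuous_src.tendsto g
  filter_upwards [bisec_mem_nhds (mem_bisec_initial hs hl),
    hr.eventually (eventually_eq_of_continuous (F.continuous_g p) hs.1),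
    hr.eventually (eventually_eq_of_continuous (F.continuous_f p) hs.1),
    hc.eventually (eventually_eq_of_continuous (F.continuous_g q) hs.2.1),
    hc.eventually (eventually_eq_of_continuous (F.continuous_f q) hs.2.1),
    hr.eventually (hh.continuousAt.preimage_mem_nhds (cyl_mem_nhds hmem.2.1)),
    hc.eventually (hh.continuousAt.preimage_mem_nhds (cyl_mem_nhds hmem.2.2.1))]
    with g' hb k1 k2 k3 k4 k5 k6
  obtain ⟨hl', -, -, hs'⟩ := mem_bisec.1 hb
  rw [BoundaryPath.d_initial, BoundaryPath.d_initial] at hl' hs'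
  obtain ⟨h1', h2'⟩ := F.shiftEq_map hs' (k1 _) (k2 _) (k3 _) (k4 _)
  refine mem_bisec.2 ⟨?_, k5, k6, ?_⟩
  · rw [BoundaryPath.d_initial, BoundaryPath.d_initial, F.map_lag hs' hl'.symm, h2']
  · rw [BoundaryPath.d_initial, BoundaryPath.d_initial]
    exact h1'

theorem continuous_map (hΛ₁ : Λ₁.FinitelyAligned) (hΛ₂ : Λ₂.FinitelyAligned)
    (hh : Continuous h) : Continuous F.map := by
  refine continuous_iff_continuousAt.2 fun g => ?_
  obtain ⟨a, b, hmem, hev⟩ := F.eventually_map_mem_bisec hΛ₁ hh g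
  rw [ContinuousAt, hΛ₂.nhds_eq hmem, tendsto_inf, tendsto_comap_iff, tendsto_principal]
  exact ⟨(hh.comp hΛ₁.continuous_rng).tendsto g, hev⟩

theorem lagAt_sub_lagAt_eq {x : Λ₁.BoundaryPath} {m n : Fin k₁ → ℕ} (hm : toE m ≤ x.deg)
    (hn : toE n ≤ x.deg) :
    toZ (F.g m ⟨x, hm⟩) - toZ (F.f m ⟨x, hm⟩) - toZ (F.g n ⟨x, hn⟩) + toZ (F.f n ⟨x, hn⟩) =
      F.lagAt m x - F.lagAt n x := by
  rw [F.lagAt_of_le hm, F.lagAt_of_le hn]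
  abel

/-- Only one inclusion is a condition, since `map` sends isotropy at `x` to isotropy at `h(x)`. -/
theorem periodPreserving_iff : F.PeriodPreserving ↔
    ∀ x, ∀ l ∈ Per (h x), ∃ g, g.rng = x ∧ g.src = x ∧ (F.map g).lag = l := by
  refine forall_congr' fun x => ?_
  have key : ∀ l, (∃ (m n : Fin k₁ → ℕ) (hm : toE m ≤ x.deg) (hn : toE n ≤ x.deg),
      PeriodPair x m n ∧ l = toZ (F.g m ⟨x, hm⟩) - toZ (F.f m ⟨x, hm⟩) - toZ (F.g n ⟨x, hn⟩)
          + toZ (F.f n ⟨x, hn⟩)) ↔ ∃ g, g.rng = x ∧ g.src = x ∧ (F.map g).lag = l := by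
    intro l
    constructor
    · rintro ⟨m, n, hm, hn, hp, rfl⟩
      refine ⟨ShiftEq.toGroupoid hp, rfl, rfl, ?_⟩
      rw [F.lagAt_sub_lagAt_eq hm hn]
      exact F.map_lag (g := ShiftEq.toGroupoid hp) hp rfl
    · rintro ⟨g, hr, hs, rfl⟩
      obtain ⟨p, q, hl, hp⟩ := g.exists_shiftEq
      rw [F.map_lag hp hl]
      rw [hr, hs] at hp ⊢
      exact ⟨p, q, hp.1, hp.2.1, hp, (F.lagAt_sub_lagAt_eq hp.1 hp.2.1).symm⟩
  constructor
  · intro e l hl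
    rw [← e] at hl
    exact (key l).1 hl
  · intro e
    refine Set.Subset.antisymm (fun l hl => ?_) (fun l hl => (key l).2 (e l hl))
    obtain ⟨g, hr, hs, hl⟩ := (key l).1 hl
    exact mem_per_iff.2 ⟨F.map g, congrArg h hr, congrArg h hs, hl⟩

/-- `Per(x) → Per(h(x))`, the restriction of `CocycleHalf.map` to the isotropy at `x`. -/
noncomputable def perHom (x : Λ₁.BoundaryPath) : perSubgroup x →+ perSubgroup (h x) where
  toFun l := ⟨(F.map (mem_per_iff.1 l.2).choose).lag, mem_per_iff.2
    ⟨_, congrArg h (mem_per_iff.1 l.2).choose_spec.1,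
      congrArg h (mem_per_iff.1 l.2).choose_spec.2.1, rfl⟩⟩
  map_zero' := by
    refine Subtype.ext ?_
    have hsp := (mem_per_iff.1 (0 : perSubgroup x).2).choose_spec
    have : (mem_per_iff.1 (0 : perSubgroup x).2).choose = BPGroupoid.unit x :=
      BPGroupoid.ext hsp.1 hsp.2.2 hsp.2.1
    exact (congrArg (fun g => (F.map g).lag) this).trans (F.map_unit_lag x)
  map_add' l l' := by
    refine Subtype.ext ?_
    have h1 := (mem_per_iff.1 l.2).choose_spec
    have h2 := (mem_per_iff.1 l'.2).choose_spec
    have h3 := (mem_per_iff.1 (l + l').2).choose_spec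
    have hc := h1.2.1.trans h2.1.symm
    have : (mem_per_iff.1 (l + l').2).choose = BPGroupoid.mul _ _ hc :=
      BPGroupoid.ext (h3.1.trans h1.1.symm)
        (h3.2.2.trans (congrArg₂ (· + ·) h1.2.2 h2.2.2).symm) (h3.2.1.trans h2.2.1.symm)
    exact (congrArg (fun g => (F.map g).lag) this).trans (F.map_mul_lag _ _ hc)

theorem perHom_apply {x : Λ₁.BoundaryPath} (l : perSubgroup x) {g : Λ₁.BPGroupoid}
    (hr : g.rng = x) (hs : g.src = x) (hl : g.lag = l) : (F.perHom x l : Fin k₂ → ℤ) =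
      (F.map g).lag := by
  have hsp := (mem_per_iff.1 l.2).choose_spec
  have : (mem_per_iff.1 l.2).choose = g :=
    BPGroupoid.ext (hsp.1.trans hr.symm) (hsp.2.2.trans hl.symm) (hsp.2.1.trans hs.symm)
  exact congrArg (fun g => (F.map g).lag) this

theorem PeriodPreserving.perHom_surjective {F : CocycleHalf h} (hF : F.PeriodPreserving)
    (x : Λ₁.BoundaryPath) : Function.Surjective (F.perHom x) := by
  intro l
  obtain ⟨g, hr, hs, hl⟩ := F.periodPreserving_iff.1 hF x l l.2
  refine ⟨⟨g.lag, mem_per_iff.2 ⟨g, hr, hs, rfl⟩⟩, Subtype.ext ?_⟩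
  rw [F.perHom_apply _ hr hs rfl, hl]

end CocycleHalf

/-- The composite `f' ∘ f` is a surjective endomorphism of a Noetherian `ℤ`-module, hence injective.
The equality `C = A` is a hypothesis because the groups used are `Per(h'(h(x)))` and `Per(x)`. -/
theorem injective_of_surjective_of_surjective {k l : ℕ} {A C : AddSubgroup (Fin k → ℤ)}
    {B : AddSubgroup (Fin l → ℤ)} (hAC : C = A) (f : A →+ B) (f' : B →+ C)
    (hf : Function.Surjective f) (hf' : Function.Surjective f') : Function.Injective f := by
  subst hAC
  have : IsNoetherian ℤ C := isNoetherian_submodule' (AddSubgroup.toIntSubmodule C)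
  have hi : Function.Injective (f'.comp f).toIntLinearMap :=
    IsNoetherian.injective_of_surjective_endomorphism _ (hf'.comp hf)
  exact Function.Injective.of_comp hi

/-! ### Inner periods, bijectivity and the resulting isomorphism. -/

namespace CocycleHalf

variable {k₁ k₂ : ℕ} {Λ₁ : KGraph.{u} k₁} {Λ₂ : KGraph.{v} k₂}
  {h : Λ₁.BoundaryPath → Λ₂.BoundaryPath} {h' : Λ₂.BoundaryPath → Λ₁.BoundaryPath}
  (F : CocycleHalf h) (F' : CocycleHalf h')

/-- The cocycles are locally constant, so one pair of degrees gives the relation at `h(y)` for all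
`y` near `x`; these `h(y)` fill a neighbourhood of `h(x)`. -/
theorem lagAt_sub_mem_IP (hc' : Continuous h') (hl : Function.LeftInverse h' h)
    (hr : Function.RightInverse h' h) {x : Λ₁.BoundaryPath} {m n : Fin k₁ → ℕ}
    (hx : InnerPeriodPair x m n) : F.lagAt m x - F.lagAt n x ∈ IP (h x) := by
  have hp : ShiftEq x m x n := hx.periodPair
  obtain ⟨-, h2⟩ := F.shiftEq_map hp rfl rfl rfl rfl
  refine ⟨_, _, innerPeriodPair_iff.2 ?_, h2.symm⟩
  have ht : Tendsto h' (𝓝 (h x)) (𝓝 x) := by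
    have := hc'.tendsto (h x)
    rwa [hl] at this
  filter_upwards [ht.eventually (innerPeriodPair_iff.1 hx),
    ht.eventually (eventually_eq_of_continuous (F.continuous_g m) hp.1),
    ht.eventually (eventually_eq_of_continuous (F.continuous_f m) hp.1),
    ht.eventually (eventually_eq_of_continuous (F.continuous_g n) hp.2.1),
    ht.eventually (eventually_eq_of_continuous (F.continuous_f n) hp.2.1)] with z hz k1 k2 k3 k4
  have hz' : ShiftEq (h' z) m (h' z) n := hz
  have := (F.shiftEq_map hz' (k1 _) (k2 _) (k3 _) (k4 _)).1
  rwa [hr] at this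

theorem innerPeriodPreserving_iff (hc' : Continuous h') (hl : Function.LeftInverse h' h)
    (hr : Function.RightInverse h' h) : F.InnerPeriodPreserving ↔
      ∀ x, ∀ l ∈ IP (h x), ∃ m n, InnerPeriodPair x m n ∧ l = F.lagAt m x - F.lagAt n x := by
  refine forall_congr' fun x => ?_
  have key : ∀ l, (∃ (m n : Fin k₁ → ℕ) (hm : toE m ≤ x.deg) (hn : toE n ≤ x.deg),
      InnerPeriodPair x m n ∧ l = toZ (F.g m ⟨x, hm⟩) - toZ (F.f m ⟨x, hm⟩)
        - toZ (F.g n ⟨x, hn⟩) + toZ (F.f n ⟨x, hn⟩)) ↔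
      ∃ m n, InnerPeriodPair x m n ∧ l = F.lagAt m x - F.lagAt n x := by
    intro l
    constructor
    · rintro ⟨m, n, hm, hn, hp, rfl⟩
      exact ⟨m, n, hp, F.lagAt_sub_lagAt_eq hm hn⟩
    · rintro ⟨m, n, hp, rfl⟩
      exact ⟨m, n, hp.periodPair.1, hp.periodPair.2.1, hp,
        (F.lagAt_sub_lagAt_eq _ _).symm⟩
  constructor
  · intro e l hl
    rw [← e] at hl
    exact (key l).1 hl
  · intro e
    refine Set.Subset.antisymm (fun l hl' => ?_) (fun l hl => (key l).2 (e l hl))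
    obtain ⟨m, n, hp, rfl⟩ := (key l).1 hl'
    exact F.lagAt_sub_mem_IP hc' hl hr hp

/-- A family that preserves inner periodicity is period-preserving. -/
theorem InnerPeriodPreserving.periodPreserving {F : CocycleHalf h} (hF : F.InnerPeriodPreserving)
    (F' : CocycleHalf h') (hΛ₁ : Λ₁.FinitelyAligned) (hΛ₂ : Λ₂.FinitelyAligned) (hc : Continuous h)
    (hc' : Continuous h') (hl : Function.LeftInverse h' h) (hr : Function.RightInverse h' h) :
    F.PeriodPreserving := by
  rw [F.periodPreserving_iff]
  intro x l hl'
  obtain ⟨g, hgr, hgs, rfl⟩ := mem_per_iff.1 hl'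
  obtain ⟨a, b, hab⟩ := exists_mem_bisec g
  obtain ⟨a', b', hab'⟩ := exists_mem_bisec (F.map (F'.map g))
  have hcont : Continuous fun k' => F.map (F'.map k') :=
    (F.continuous_map hΛ₁ hΛ₂ hc).comp (F'.continuous_map hΛ₂ hΛ₁ hc')
  -- For `k'` near `g` both `k'` and `F(F'(k'))` keep their lags and have the same range and source.
  -- The ranges fill a neighbourhood of `h(x)`, so the difference of the two lags is an inner period
  -- there.
  have hW := hΛ₂.isOpenMap_rng.image_mem_nhds (inter_mem (bisec_mem_nhds hab)
    (hcont.continuousAt.preimage_mem_nhds (bisec_mem_nhds hab')))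
  rw [hgr] at hW
  have hip : InnerPeriodPair (h x) _ _ := innerPeriodPair_iff.2 (by
    filter_upwards [hW]
    rintro _ ⟨k', ⟨hk, hk'⟩, rfl⟩
    have h1 := (mem_bisec.1 hk).2.2.2
    have h2 : ShiftEq (h (h' k'.rng)) (Λ₂.d a') (h (h' k'.src)) (Λ₂.d b') :=
      (mem_bisec.1 hk').2.2.2
    rw [hr, hr] at h2
    exact h2.trans h1.symm)
  obtain ⟨m, n, hmn, e⟩ := (F.innerPeriodPreserving_iff hc' hl hr).1 hF x _ ⟨_, _, hip, rfl⟩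
  have hp : ShiftEq x m x n := hmn.periodPair
  have hrx : (F'.map g).rng = x := (congrArg h' hgr).trans (hl x)
  have hsx : (F'.map g).src = x := (congrArg h' hgs).trans (hl x)
  -- The inner period `m - n` of `x` maps to that difference, so dividing `F'(g)` by it removes the
  -- error.
  refine ⟨(F'.map g).mul hp.toGroupoid.inv hsx, hrx, rfl, ?_⟩
  refine (F.map_mul_lag _ _ _).trans ?_
  rw [F.map_inv_lag, F.map_lag (g := hp.toGroupoid) hp rfl]
  change _ + -(F.lagAt m x - F.lagAt n x) = _
  rw [← e, (mem_bisec.1 hab').1, (mem_bisec.1 hab).1]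
  funext i
  simp only [toZ, Pi.sub_apply, Pi.add_apply, Pi.sup_apply, Pi.neg_apply]
  omega

/-- Elements with equal images have equal range and source; their quotient is isotropy in the kernel
of `perHom`, which is trivial. -/
theorem map_injective (hF : F.PeriodPreserving) (hF' : F'.PeriodPreserving)
    (hl : Function.LeftInverse h' h) : Function.Injective F.map := by
  intro g g' e
  have hr : g.rng = g'.rng := hl.injective (congrArg BPGroupoid.rng e)
  have hs : g.src = g'.src := hl.injective (congrArg BPGroupoid.src e)
  refine BPGroupoid.ext hr ?_ hs
  have hinj := injective_of_surjective_of_surjective (by rw [hl g.rng]) (F.perHom g.rng)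
    (F'.perHom (h g.rng)) (hF.perHom_surjective _) (hF'.perHom_surjective _)
  let t := g.mul g'.inv hs
  have ht : t.src = g.rng := hr.symm
  let l : perSubgroup g.rng := ⟨t.lag, mem_per_iff.2 ⟨t, rfl, ht, rfl⟩⟩
  have h0 : F.perHom g.rng l = 0 := by
    refine Subtype.ext ?_
    rw [F.perHom_apply l (g := t) rfl ht rfl, F.map_mul_lag g g'.inv hs,
      F.map_inv_lag, e, add_neg_cancel]
    rfl
  have hl0 : l = 0 := hinj (h0.trans (map_zero _).symm)
  have : g.lag + -g'.lag = 0 := congrArg Subtype.val hl0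
  exact eq_of_sub_eq_zero (by rw [sub_eq_add_neg, this])

/-- Orbit equivalence gives `t` whose image has the range and source of `g`. The error `g F(t)⁻¹` is
isotropy at `h(x)`, and period preservation lifts it to `x`. -/
theorem map_surjective (hF : F.PeriodPreserving) (hr : Function.RightInverse h' h)
    (horb : ∀ x, h '' orb x = orb (h x)) : Function.Surjective F.map := by
  intro g
  have hmem : g.rng ∈ orb (h (h' g.src)) := by
    rw [hr]
    exact mem_orb_iff.2 ⟨g, rfl, rfl⟩
  rw [← horb] at hmem
  obtain ⟨x, hx, hxg⟩ := hmem
  obtain ⟨t, htr, hts⟩ := mem_orb_iff.1 hx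
  have htr' : (F.map t).rng = g.rng := (congrArg h htr).trans hxg
  have hts' : (F.map t).src = g.src := (congrArg h hts).trans (hr _)
  obtain ⟨e, her, hes, hel⟩ := F.periodPreserving_iff.1 hF x (g.lag - (F.map t).lag)
    (mem_per_iff.2 ⟨g.mul (F.map t).inv hts'.symm, hxg.symm, htr'.trans hxg.symm,
      (sub_eq_add_neg _ _).symm⟩)
  refine ⟨e.mul t (hes.trans htr.symm), BPGroupoid.ext ?_ ?_ hts'⟩
  · exact (congrArg h her).trans hxg
  · rw [F.map_mul_lag, hel, sub_add_cancel]

/-- The isomorphism of boundary path groupoids defined by a period-preserving family. -/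
noncomputable def mapHomeomorph (hbij : Function.Bijective F.map) (hΛ₁ : Λ₁.FinitelyAligned)
    (hΛ₂ : Λ₂.FinitelyAligned) (hc : Continuous h) (hc' : Continuous h')
    (hl : Function.LeftInverse h' h) : Λ₁.BPGroupoid ≃ₜ Λ₂.BPGroupoid where
  toEquiv := Equiv.ofBijective F.map hbij
  continuous_toFun := F.continuous_map hΛ₁ hΛ₂ hc
  continuous_invFun := by
    refine continuous_iff_continuousAt.2 fun g => ?_
    obtain ⟨t, rfl⟩ := hbij.2 g
    have hinv : ∀ s, (Equiv.ofBijective F.map hbij).symm (F.map s) = s :=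
      (Equiv.ofBijective F.map hbij).symm_apply_apply
    obtain ⟨a, b, hab⟩ := exists_mem_bisec t
    obtain ⟨c, d, hcd, hev⟩ := F.eventually_map_mem_bisec hΛ₁ hc t
    have hW := hΛ₁.isOpenMap_rng.image_mem_nhds (inter_mem (bisec_mem_nhds hab) hev)
    have hrng : ∀ s, ((Equiv.ofBijective F.map hbij).symm s).rng = h' s.rng := by
      intro s
      obtain ⟨s, rfl⟩ := hbij.2 s
      rw [hinv]
      exact (hl _).symm
    have ht : Tendsto (fun s : Λ₂.BPGroupoid => h' s.rng) (𝓝 (F.map t)) (𝓝 t.rng) := by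
      have := (hc'.comp hΛ₂.continuous_rng).tendsto (F.map t)
      rwa [Function.comp_apply, show h' (F.map t).rng = t.rng from hl _] at this
    change Tendsto (Equiv.ofBijective F.map hbij).symm _
      (𝓝 ((Equiv.ofBijective F.map hbij).symm (F.map t)))
    rw [hinv, hΛ₁.nhds_eq hab, tendsto_inf, tendsto_comap_iff, tendsto_principal]
    refine ⟨ht.congr fun s => (hrng s).symm, ?_⟩
    -- The preimage of a nearby point has the range of some `e ∈ Z(a *_s b)`, and both images lie in
    -- `Z(c *_s d)`; hence they coincide.
    filter_upwards [bisec_mem_nhds hcd, ht.eventually hW] with s hs hsW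
    obtain ⟨e, ⟨heab, hecd⟩, her⟩ := hsW
    obtain ⟨s, rfl⟩ := hbij.2 s
    have hse : s.rng = e.rng := ((hl _).symm.trans her.symm)
    have : F.map s = F.map e := eq_of_mem_bisec hs hecd (congrArg h hse)
    rw [this, hinv]
    exact heab

/-- `F'` turns an inner period of `h(x)` into one of `x`, and `F` sends it back. -/
theorem innerPeriodPreserving_of_map_map (hF : ∀ g, F.map (F'.map g) = g)
    (hc : Continuous h) (hc' : Continuous h')
    (hl : Function.LeftInverse h' h) (hr : Function.RightInverse h' h) :
    F.InnerPeriodPreserving := by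
  rw [F.innerPeriodPreserving_iff hc' hl hr]
  rintro x _ ⟨P, Q, hPQ, rfl⟩
  obtain ⟨m, n, hmn, e⟩ := F'.lagAt_sub_mem_IP hc hr hl hPQ
  rw [hl] at hmn
  have hs : ShiftEq (h x) P (h x) Q := hPQ.periodPair
  have hs' : ShiftEq x m x n := hmn.periodPair
  refine ⟨m, n, hmn, ?_⟩
  have h1 : F'.map hs.toGroupoid = hs'.toGroupoid :=
    BPGroupoid.ext (hl x) ((F'.map_lag (g := hs.toGroupoid) hs rfl).trans e) (hl x)
  have h2 := congrArg BPGroupoid.lag (hF hs.toGroupoid)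
  rw [h1, F.map_lag (g := hs'.toGroupoid) hs' rfl] at h2
  exact h2.symm

theorem lagAt_zero (x : Λ₁.BoundaryPath) : F.lagAt 0 x = 0 := by
  have h0 : toE (0 : Fin k₁ → ℕ) ≤ x.deg := toE_zero_le _
  have e := F.lagAt_add (n := 0) h0 (by rw [add_zero]; exact h0)
  have hs : x.shift 0 h0 = x := by
    refine BoundaryPath.ext_seg ?_ fun p q hpq _ _ => x.seg_congr (add_zero p) (add_zero q) _ _ _ _
    funext i
    exact tsub_zero _
  rw [hs, add_zero] at e
  exact left_eq_add.1 e

theorem graded_of_cocycle_map {Γ : Type w} [Group Γ] {η₁ : Λ₁.GroupFunctor Γ}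
    {η₂ : Λ₂.GroupFunctor Γ} (hF : ∀ g, η₂.cocycle (F.map g) = η₁.cocycle g) :
    F.Graded η₁ η₂ := by
  intro m x hx
  have hs := shiftEq_shift_zero hx
  have h1 := hF hs.toGroupoid
  have hl := F.map_lag (g := hs.toGroupoid) hs rfl
  have hl' : (F.map hs.toGroupoid).lag = F.lagAt m x - F.lagAt 0 (x.shift m hx) := hl
  -- Since `lagAt 0` vanishes, `g_m(x)` and `f_m(x)` represent the image of `(x, m, σ^m(x))`, and
  -- `c_η` may be evaluated with them.
  rw [F.lagAt_zero, sub_zero, F.lagAt_of_le hx] at hl'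
  have hs' := F.shiftEq_cocycle hx
  rw [η₁.cocycle_eq hs.toGroupoid hs.1 hs.2.1 rfl hs.2.2,
    η₂.cocycle_eq (F.map hs.toGroupoid) hs'.1 hs'.2.1 hl'.symm hs'.2.2] at h1
  refine Eq.trans ?_ h1.symm
  have e : (x.shift m hx).initial 0 hs.2.1 = Λ₁.one ((x.shift m hx).vert 0 hs.2.1) :=
    (x.shift m hx).seg_self 0 hs.2.1
  change _ = η₁.map (x.initial m hx) * (η₁.map ((x.shift m hx).initial 0 hs.2.1))⁻¹
  rw [e, η₁.map_one, inv_one, mul_one]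

end CocycleHalf

/-! ### Cocycles obtained from a continuous homomorphism. -/

section OfIso

variable {k : ℕ} {Λ : KGraph.{u} k}

/-- Locally constant choice of a bisection around each element of the groupoid. -/
theorem FinitelyAligned.exists_isLocallyConstant_bisec (hΛ : Λ.FinitelyAligned) :
    ∃ t : Λ.BPGroupoid → Λ.Mor × Λ.Mor, IsLocallyConstant t ∧
      ∀ g, g ∈ Λ.bisec (t g).1 (t g).2 := by
  classical
  have := Λ.countable_mor
  obtain ⟨e, he⟩ := exists_injective_nat (Λ.Mor × Λ.Mor)
  have hex : ∀ g : Λ.BPGroupoid, ∃ n, ∃ c, e c = n ∧ g ∈ Λ.bisec c.1 c.2 := fun g =>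
    let ⟨a, b, h⟩ := exists_mem_bisec g
    ⟨_, (a, b), rfl, h⟩
  have hspec := fun g => Nat.find_spec (hex g)
  choose t ht1 ht2 using hspec
  refine ⟨t, (IsLocallyConstant.iff_eventually_eq t).2 fun g => ?_, ht2⟩
  -- `t g` is the first bisection containing `g` in a fixed enumeration. Nearby elements avoid the
  -- finitely many earlier ones, which are closed, and stay in `t g`, which is open.
  have h1 : ∀ᶠ g' in 𝓝 g, ∀ n ∈ Set.Iio (e (t g)), ¬ ∃ c, e c = n ∧ g' ∈ Λ.bisec c.1 c.2 := by
    rw [eventually_all_finite (Set.finite_Iio _)]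
    intro n hn
    by_cases hc : ∃ c, e c = n
    · obtain ⟨c, rfl⟩ := hc
      have hg : g ∉ Λ.bisec c.1 c.2 := by
        intro hg
        rw [Set.mem_Iio, ht1] at hn
        exact Nat.find_min (hex g) hn ⟨c, rfl, hg⟩
      filter_upwards [(hΛ.isClosed_bisec c.1 c.2).isOpen_compl.mem_nhds hg] with g' hg'
      rintro ⟨c', hc', hm⟩
      rw [he hc'] at hm
      exact hg' hm
    · exact Eventually.of_forall fun g' ⟨c, h, _⟩ => hc ⟨c, h⟩
  filter_upwards [h1, bisec_mem_nhds (ht2 g)] with g' h1 h2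
  refine he ((ht1 g').trans ?_)
  refine (Nat.find_eq_iff (hex g')).2 ⟨⟨_, rfl, h2⟩, fun n hn => h1 n hn⟩

theorem FinitelyAligned.continuous_toGroupoid_shift (hΛ : Λ.FinitelyAligned) (m : Fin k → ℕ) :
    Continuous fun x : {x : Λ.BoundaryPath // toE m ≤ x.deg} =>
      (shiftEq_shift_zero x.2).toGroupoid := by
  refine continuous_iff_continuousAt.2 fun x => ?_
  have hs := shiftEq_shift_zero x.2
  have hmem : hs.toGroupoid ∈ Λ.bisec (x.1.initial m hs.1) ((x.1.shift m x.2).initial 0 hs.2.1) :=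
    mem_bisec_initial (g := hs.toGroupoid) hs rfl
  rw [ContinuousAt, hΛ.nhds_eq hmem, tendsto_inf, tendsto_comap_iff, tendsto_principal]
  refine ⟨continuous_subtype_val.tendsto x, ?_⟩
  filter_upwards [continuous_subtype_val.continuousAt.preimage_mem_nhds
    (cyl_mem_nhds (x.1.mem_cyl_initial m x.2)), (continuous_shift m).continuousAt.preimage_mem_nhds
    (cyl_mem_nhds ((x.1.shift m x.2).mem_cyl_initial 0 hs.2.1))] with y h1 h2
  have hy := shiftEq_shift_zero y.2
  refine mem_bisec.2 ⟨?_, h1, h2, ?_⟩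
  · rw [BoundaryPath.d_initial, BoundaryPath.d_initial]
    rfl
  · rw [BoundaryPath.d_initial, BoundaryPath.d_initial]
    exact hy

variable {k₁ k₂ : ℕ} {Λ₁ : KGraph.{u} k₁} {Λ₂ : KGraph.{v} k₂}
  {h : Λ₁.BoundaryPath → Λ₂.BoundaryPath}

/-- A continuous homomorphism of boundary path groupoids over `h` comes from a family of
cocycles. -/
theorem exists_cocycleHalf (hΛ₁ : Λ₁.FinitelyAligned) (hΛ₂ : Λ₂.FinitelyAligned)
    {φ : Λ₁.BPGroupoid → Λ₂.BPGroupoid} (hφ : Continuous φ) (hr : ∀ g, (φ g).rng = h g.rng)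
    (hs : ∀ g, (φ g).src = h g.src)
    (hmul : ∀ g g' hc, (φ (g.mul g' hc)).lag = (φ g).lag + (φ g').lag) :
    ∃ F : CocycleHalf h, ∀ g, F.map g = φ g := by
  obtain ⟨t, ht, htm⟩ := hΛ₂.exists_isLocallyConstant_bisec
  let T : (m : Fin k₁ → ℕ) → {x : Λ₁.BoundaryPath // toE m ≤ x.deg} → Λ₁.BPGroupoid :=
    fun m x => (shiftEq_shift_zero x.2).toGroupoid
  have hT : ∀ m, Continuous fun x => φ (T m x) := fun m =>
    hφ.comp (hΛ₁.continuous_toGroupoid_shift m)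
  have hlag : ∀ m x, toZ (Λ₂.d (t (φ (T m x))).1) - toZ (Λ₂.d (t (φ (T m x))).2) =
      (φ (T m x)).lag := fun m x => (mem_bisec.1 (htm _)).1.symm
  have hsh : ∀ m x, ShiftEq (h x.1) (Λ₂.d (t (φ (T m x))).1) (h (x.1.shift m x.2))
      (Λ₂.d (t (φ (T m x))).2) := by
    intro m x
    have := (mem_bisec.1 (htm (φ (T m x)))).2.2.2
    rwa [hr, hs] at this
  let F : CocycleHalf h :=
    { f := fun m x => Λ₂.d (t (φ (T m x))).2
      g := fun m x => Λ₂.d (t (φ (T m x))).1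
      continuous_f := fun m => ((ht.comp fun c => Λ₂.d c.2).continuous).comp (hT m)
      continuous_g := fun m => ((ht.comp fun c => Λ₂.d c.1).continuous).comp (hT m)
      f_le := fun m x => (hsh m x).2.1
      g_le := fun m x => (hsh m x).1
      shift_eq := fun m x => (hsh m x).2.2.symm
      cocycle := by
        intro m n x hx
        rw [add_sub_assoc, hlag, hlag, hlag]
        -- The cocycle identity is multiplicativity of `φ` on `(x, m, σ^m(x)) (σ^m(x), n,
        -- σ^{m+n}(x))`.
        have hc : (T m ⟨x, toE_le_left hx⟩).src =
          (T n ⟨x.shift m (toE_le_left hx), BoundaryPath.le_shift_deg hx⟩).rng := rfl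
        rw [← hmul _ _ hc]
        congr 2
        refine BPGroupoid.ext rfl ?_
          (x.shift_shift rfl hx (toE_le_left hx) (BoundaryPath.le_shift_deg hx)).symm
        change toZ (m + n) - toZ 0 = toZ m - toZ 0 + (toZ n - toZ 0)
        funext i
        simp [toZ] }
  refine ⟨F, fun g => BPGroupoid.ext (hr g).symm ?_ (hs g).symm⟩
  obtain ⟨p, q, hl, hpq⟩ := g.exists_shiftEq
  have h1 : ∀ m x (hm : toE m ≤ x.deg), F.lagAt m x = (φ (T m ⟨x, hm⟩)).lag := fun m x hm =>
    (F.lagAt_of_le hm).trans (hlag m ⟨x, hm⟩)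
  rw [F.map_lag hpq hl, h1 p _ hpq.1, h1 q _ hpq.2.1, sub_eq_iff_eq_add]
  -- With `g = (x, p - q, y)`, the product `g (y, q, σ^q(y))` is `(x, p, σ^p(x))`.
  have hc : g.src = (T q ⟨g.src, hpq.2.1⟩).rng := rfl
  rw [← hmul _ _ hc]
  congr 2
  refine BPGroupoid.ext rfl ?_ hpq.2.2
  change toZ p - toZ 0 = g.lag + (toZ q - toZ 0)
  rw [← hl]
  abel

end OfIso

/-! ### Consequences of an isomorphism of groupoids. -/

section Iso

variable {k₁ k₂ : ℕ} {Λ₁ : KGraph.{u} k₁} {Λ₂ : KGraph.{v} k₂}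
  {φ : Λ₁.BPGroupoid ≃ₜ Λ₂.BPGroupoid} {h : Λ₁.BoundaryPath ≃ₜ Λ₂.BoundaryPath}

theorem IsGroupoidIso.rng_eq (hφ : IsGroupoidIso φ)
    (hu : ∀ x, φ (BPGroupoid.unit x) = BPGroupoid.unit (h x)) (g : Λ₁.BPGroupoid) :
    (φ g).rng = h g.rng := by
  obtain ⟨e, -⟩ := hφ (BPGroupoid.unit g.rng) g rfl
  rw [hu] at e
  exact e.symm

theorem IsGroupoidIso.src_eq (hφ : IsGroupoidIso φ)
    (hu : ∀ x, φ (BPGroupoid.unit x) = BPGroupoid.unit (h x)) (g : Λ₁.BPGroupoid) :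
    (φ g).src = h g.src := by
  obtain ⟨e, -⟩ := hφ g (BPGroupoid.unit g.src) rfl
  rw [hu] at e
  exact e

/-- That `φ` reflects composability is not part of `IsGroupoidIso`; it follows from `rng_eq`,
`src_eq` and the injectivity of `h`. -/
theorem IsGroupoidIso.symm (hφ : IsGroupoidIso φ)
    (hu : ∀ x, φ (BPGroupoid.unit x) = BPGroupoid.unit (h x)) : IsGroupoidIso φ.symm := by
  intro a b hab
  obtain ⟨a, rfl⟩ := φ.surjective a
  obtain ⟨b, rfl⟩ := φ.surjective b
  have hab' : a.src = b.rng := by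
    rw [hφ.src_eq hu, hφ.rng_eq hu] at hab
    exact h.injective hab
  obtain ⟨e, he⟩ := hφ a b hab'
  refine ⟨by rwa [φ.symm_apply_apply, φ.symm_apply_apply], ?_⟩
  rw [← he, φ.symm_apply_apply]
  congr 1 <;> rw [φ.symm_apply_apply]

theorem IsGroupoidIso.exists_cocycleFamily (hφ : IsGroupoidIso φ) (hΛ₁ : Λ₁.FinitelyAligned)
    (hΛ₂ : Λ₂.FinitelyAligned) (hu : ∀ x, φ (BPGroupoid.unit x) = BPGroupoid.unit (h x)) :
    ∃ F : CocycleFamily h, (∀ g, F.fg.map g = φ g) ∧ ∀ g, F.ij.map g = φ.symm g := by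
  have hu' : ∀ y, φ.symm (BPGroupoid.unit y) = BPGroupoid.unit (h.symm y) := fun y => by
    rw [φ.symm_apply_eq, hu, h.apply_symm_apply]
  obtain ⟨F, hF⟩ := exists_cocycleHalf hΛ₁ hΛ₂ φ.continuous (hφ.rng_eq hu) (hφ.src_eq hu)
    fun g g' hc => by
      obtain ⟨e, he⟩ := hφ g g' hc
      rw [he]
      rfl
  obtain ⟨F', hF'⟩ := exists_cocycleHalf hΛ₂ hΛ₁ φ.symm.continuous ((hφ.symm hu).rng_eq hu')
    ((hφ.symm hu).src_eq hu') fun g g' hc => by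
      obtain ⟨e, he⟩ := hφ.symm hu g g' hc
      rw [he]
      rfl
  exact ⟨⟨F, F'⟩, hF, hF'⟩

theorem IsGroupoidIso.isOrbitEquivalence (hφ : IsGroupoidIso φ)
    (hu : ∀ x, φ (BPGroupoid.unit x) = BPGroupoid.unit (h x)) : IsOrbitEquivalence h := by
  intro x
  ext y
  constructor
  · rintro ⟨z, hz, rfl⟩
    obtain ⟨g, rfl, rfl⟩ := mem_orb_iff.1 hz
    exact mem_orb_iff.2 ⟨φ g, hφ.rng_eq hu g, hφ.src_eq hu g⟩
  · intro hy
    obtain ⟨g, rfl, hs⟩ := mem_orb_iff.1 hy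
    obtain ⟨g, rfl⟩ := φ.surjective g
    rw [hφ.src_eq hu] at hs
    exact ⟨g.rng, mem_orb_iff.2 ⟨g, rfl, h.injective hs⟩, (hφ.rng_eq hu g).symm⟩

end Iso

end KGraph

theorem proposition3p6 {Γ : Type w} [Group Γ] {k₁ k₂ : ℕ}
    (Λ₁ : KGraph.{u} k₁) (Λ₂ : KGraph.{v} k₂)
    (hΛ₁ : Λ₁.FinitelyAligned) (hΛ₂ : Λ₂.FinitelyAligned)
    (η₁ : Λ₁.GroupFunctor Γ) (η₂ : Λ₂.GroupFunctor Γ)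
    (h : Λ₁.BoundaryPath ≃ₜ Λ₂.BoundaryPath) :
    List.TFAE [
      ∃ φ : Λ₁.BPGroupoid ≃ₜ Λ₂.BPGroupoid, KGraph.IsGroupoidIso φ ∧
        (∀ a, η₂.cocycle (φ a) = η₁.cocycle a) ∧
        ∀ x, φ (KGraph.BPGroupoid.unit x) = KGraph.BPGroupoid.unit (h x),
      KGraph.IsOrbitEquivalence h ∧
        ∃ F : KGraph.CocycleFamily h, F.Graded η₁ η₂ ∧ F.PeriodPreserving,
      KGraph.IsOrbitEquivalence h ∧
        ∃ F : KGraph.CocycleFamily h, F.Graded η₁ η₂ ∧ F.InnerPeriodPreserving] := by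
  tfae_have 1 → 3 := by
    rintro ⟨φ, hφ, hη, hu⟩
    obtain ⟨F, hF, hF'⟩ := hφ.exists_cocycleFamily hΛ₁ hΛ₂ hu
    have hη' : ∀ a, η₁.cocycle (φ.symm a) = η₂.cocycle a := fun a => by
      rw [← hη, φ.apply_symm_apply]
    refine ⟨hφ.isOrbitEquivalence hu, F, ⟨F.fg.graded_of_cocycle_map fun g => by rw [hF, hη],
      F.ij.graded_of_cocycle_map fun g => by rw [hF', hη']⟩, ?_, ?_⟩
    · exact F.fg.innerPeriodPreserving_of_map_map F.ij
        (fun g => by rw [hF, hF', φ.apply_symm_apply]) h.continuous h.symm.continuous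
        h.left_inv h.right_inv
    · exact F.ij.innerPeriodPreserving_of_map_map F.fg
        (fun g => by rw [hF, hF', φ.symm_apply_apply]) h.symm.continuous h.continuous
        h.right_inv h.left_inv
  tfae_have 3 → 2 := by
    rintro ⟨ho, F, hη, hF, hF'⟩
    exact ⟨ho, F, hη, hF.periodPreserving F.ij hΛ₁ hΛ₂ h.continuous h.symm.continuous
      h.left_inv h.right_inv, hF'.periodPreserving F.fg hΛ₂ hΛ₁ h.symm.continuous h.continuous
      h.right_inv h.left_inv⟩
  -- The isomorphism is defined by `F.fg` alone; `F.ij` enters only through injectivity.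
  tfae_have 2 → 1 := by
    rintro ⟨ho, F, hη, hF, hF'⟩
    have hbij : Function.Bijective F.fg.map :=
      ⟨F.fg.map_injective F.ij hF hF' h.left_inv, F.fg.map_surjective hF h.right_inv ho⟩
    refine ⟨F.fg.mapHomeomorph hbij hΛ₁ hΛ₂ h.continuous h.symm.continuous h.left_inv,
      fun a b hab => ⟨congrArg h hab, F.fg.map_mul a b hab⟩, F.fg.cocycle_map hη.1,
      F.fg.map_unit⟩
  tfae_finish
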